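/- Let $\gamma=(1+\sqrt5)/2$. For an algebraic number $\alpha\in\mathbb C$, let $H(\alpha)$ denote the maximum of the absolute values of the coefficients of its irreducible polynomial over $\mathbb Z$. A real number $\xi$ is called *extremal* if it is neither rational nor quadratic irrational and there is a constant $c>0$ such that for every real $X\ge1$ the inequalities $$|x_0|\le X,\quad |x_0\xi-x_1|\le cX^{-1/\gamma},\quad |x_0\xi^2-x_2|\le cX^{-1/\gamma}$$ have a non-zero solution $(x_0,x_1,x_2)\in\mathbb Z^3$. For $\mathbf x=(x_0,x_1,x_2)\in\mathbb Z^3$ put $\|\mathbf x\|=\max\{|x_0|,|x_1|,|x_2|\}$, $L(\mathbf x)=\max\{|x_0\xi-x_1|,|x_0\xi^2-x_2|\}$, $\det(\mathbf x)=x_0x_2-x_1^2$, and let $\det(\mathbf x,\mathbf y,\mathbf z)$ be the determinant of the matrix with rows $\mathbf x,\mathbf y,\mathbf z$. Write $A_k\ll B_k$ if $A_k\le cB_k$ for all $k\ge1$ with a constant $c>0$ independent of $k$, and $A_k\sim B_k$ if $A_k\ll B_k\ll A_k$. Call a pair consisting of a strictly increasing sequence of positive integers $(Y_k)_{k\ge1}$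 and a sequence $(\mathbf y_k)_{k\ge1}$ of points of $\mathbb Z^3$ *admissible for $\xi$* if, for all $k\ge1$, $$Y_{k+1}\sim Y_k^{\gamma},\quad \|\mathbf y_k\|\sim Y_k,\quad L(\mathbf y_k)\sim Y_k^{-1},\quad 1\le|\det(\mathbf y_k)|\ll1,\quad 1\le|\det(\mathbf y_k,\mathbf y_{k+1},\mathbf y_{k+2})|\ll1,$$ and for such a pair let $Q_k(T)\in\mathbb Z[T]$ be the determinant of the $3\times3$ matrix with rows $(1,T,T^2)$, $\mathbf y_k$, $\mathbf y_{k+1}$. **Theorem 8.2.** Let $\xi$ be an extremal real number. Then there exist pairs of sequences admissible for $\xi$, and for every such pair there exist an integer $k_0\ge1$ and constants $c_1,c_2>0$ such that, for every $k\ge k_0$, the polynomial $Q_k$ is irreducible over $\mathbb Q$ of degree $2$ and has exactly one root $\alpha_k\in\mathbb C$ with $$c_1H(\alpha_k)^{-2\gamma^2}\le|\xi-\alpha_k|\le c_2H(\alpha_k)^{-2\gamma^2};$$ moreover there exists a constant $c_3>0$ such that, for every algebraic number $\alpha\in\mathbb C$ of degree $\le2$ over $\mathbb Q$ distinct from all $\alpha_k$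 with $k\ge k_0$, $$|\xi-\alpha|\ge c_3H(\alpha)^{-4}.$$ Consequently (Theorem 1.4), there is a value of $c>0$ such that $|\xi-\alpha|\le cH(\alpha)^{-2\gamma^2}$ has infinitely many solutions in algebraic numbers $\alpha\in\mathbb C$ of degree $2$, and another value of $c>0$ such that the same inequality has no solution in algebraic numbers $\alpha\in\mathbb C$ of degree at most $2$. -/

import Mathlib

open Polynomial

noncomputable section

/-- A real number `ξ` is extremal if it is neither rational nor quadratic irrational and if, for
some constant `c > 0`, the system `|x₀| ≤ X`, `|x₀ξ - x₁| ≤ c X^{-1/γ}`, `|x₀ξ² - x₂| ≤ c X^{-1/γ}`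
has a non-zero integer solution for every real number `X ≥ 1`. -/
def IsExtremal (ξ : ℝ) : Prop :=
  Irrational ξ ∧ ¬ (IsAlgebraic ℚ ξ ∧ (minpoly ℚ ξ).natDegree = 2) ∧
    ∃ c : ℝ, 0 < c ∧ ∀ X : ℝ, 1 ≤ X → ∃ x₀ x₁ x₂ : ℤ, (x₀, x₁, x₂) ≠ (0, 0, 0) ∧
      |(x₀ : ℝ)| ≤ X ∧
      |(x₀ : ℝ) * ξ - x₁| ≤ c * X ^ (-1 / Real.goldenRatio) ∧
      |(x₀ : ℝ) * ξ ^ 2 - x₂| ≤ c * X ^ (-1 / Real.goldenRatio)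

/-- The norm `‖x‖ = max (|x₀|, |x₁|, |x₂|)` of an integral point. -/
def ptNorm (x : Fin 3 → ℤ) : ℝ := max |(x 0 : ℝ)| (max |(x 1 : ℝ)| |(x 2 : ℝ)|)

/-- `L(x) = max (|x₀ξ - x₁|, |x₀ξ² - x₂|)`. -/
def ptL (ξ : ℝ) (x : Fin 3 → ℤ) : ℝ :=
  max |(x 0 : ℝ) * ξ - x 1| |(x 0 : ℝ) * ξ ^ 2 - x 2|

/-- The determinant of the symmetric matrix with rows `(x₀, x₁)` and `(x₁, x₂)`. -/
def symDet (x : Fin 3 → ℤ) : ℤ := x 0 * x 2 - x 1 ^ 2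

/-- The determinant of the matrix with rows `x`, `y`, `z`. -/
def det3 (x y z : Fin 3 → ℤ) : ℤ := (Matrix.of ![x, y, z]).det

/-- `A k ≪ B k` for `k ≥ 1`: the ratio is bounded above by a constant independent of `k`. -/
def LessLess (A B : ℕ → ℝ) : Prop := ∃ c : ℝ, 0 < c ∧ ∀ k, 1 ≤ k → A k ≤ c * B k

/-- `A k ∼ B k` for `k ≥ 1`, meaning `A ≪ B ≪ A`. -/
def SameOrder (A B : ℕ → ℝ) : Prop := LessLess A B ∧ LessLess B A

/-- `Y` is a (strictly) increasing sequence of positive integers and `y` is a sequence of points of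
`ℤ³`, both indexed by `k ≥ 1` (the value at index `0` plays no role), such that for `k ≥ 1`
`Y_{k+1} ∼ Y_k^γ`, `‖y_k‖ ∼ Y_k`, `L(y_k) ∼ Y_k⁻¹`, `1 ≤ |det y_k| ≪ 1` and
`1 ≤ |det (y_k, y_{k+1}, y_{k+2})| ≪ 1`. -/
structure IsApproxSeq (ξ : ℝ) (Y : ℕ → ℕ) (y : ℕ → Fin 3 → ℤ) : Prop where
  pos : ∀ k, 1 ≤ k → 0 < Y k
  strictMono : ∀ k, 1 ≤ k → Y k < Y (k + 1)
  growth : SameOrder (fun k => (Y (k + 1) : ℝ)) (fun k => (Y k : ℝ) ^ Real.goldenRatio)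
  norm : SameOrder (fun k => ptNorm (y k)) (fun k => (Y k : ℝ))
  approx : SameOrder (fun k => ptL ξ (y k)) (fun k => (Y k : ℝ)⁻¹)
  one_le_symDet : ∀ k, 1 ≤ k → 1 ≤ |symDet (y k)|
  symDet_bdd : LessLess (fun k => |(symDet (y k) : ℝ)|) (fun _ => 1)
  one_le_det3 : ∀ k, 1 ≤ k → 1 ≤ |det3 (y k) (y (k + 1)) (y (k + 2))|
  det3_bdd : LessLess (fun k => |(det3 (y k) (y (k + 1)) (y (k + 2)) : ℝ)|) (fun _ => 1)

/-- The polynomial `Q_k(T)`, the determinant of the matrix with rows `(1, T, T²)`, `y_k`,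
`y_{k+1}`. -/
def Qpoly (y : ℕ → Fin 3 → ℤ) (k : ℕ) : ℤ[X] :=
  Matrix.det !![1, X, X ^ 2;
    C (y k 0), C (y k 1), C (y k 2);
    C (y (k + 1) 0), C (y (k + 1) 1), C (y (k + 1) 2)]

/-- The irreducible polynomial over `ℤ` of an algebraic number `α` (defined up to sign): the
primitive part of the minimal polynomial of `α` over `ℚ` with its denominators cleared. -/
def intMinpoly (α : ℂ) : ℤ[X] :=
  (IsLocalization.integerNormalization (nonZeroDivisors ℤ) (minpoly ℚ α)).primPart

/-- The height `H(α)`: the maximum of the absolute values of the coefficients of the irreducible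
polynomial of `α` over `ℤ`. -/
def algHeight (α : ℂ) : ℝ := (intMinpoly α).supNorm

theorem aeval_intMinpoly {α : ℂ} (hα : IsAlgebraic ℚ α) : aeval α (intMinpoly α) = 0 := by
  apply aeval_primPart_eq_zero
  · rw [Ne, IsLocalization.integerNormalization_eq_zero_iff le_rfl]
    exact minpoly.ne_zero hα.isIntegral
  · exact IsLocalization.integerNormalization_aeval_eq_zero _ _ (minpoly.aeval ℚ α)

theorem irreducible_intMinpoly {α : ℂ} (hα : IsAlgebraic ℚ α) : Irreducible (intMinpoly α) := by
  have hp : (intMinpoly α).IsPrimitive := isPrimitive_primPart _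
  rw [hp.irreducible_iff_irreducible_map_fraction_map (K := ℚ)]
  have hirr := minpoly.irreducible hα.isIntegral
  have h0 : (intMinpoly α).map (algebraMap ℤ ℚ) ≠ 0 := by
    rw [Ne, Polynomial.map_eq_zero_iff (IsFractionRing.injective ℤ ℚ)]
    exact hp.ne_zero
  have hdeg : (intMinpoly α).natDegree = (minpoly ℚ α).natDegree := by
    rw [intMinpoly, natDegree_primPart]
    obtain ⟨b, hb, h⟩ := IsLocalization.integerNormalization_spec (nonZeroDivisors ℤ) (minpoly ℚ α)
    have hb0 : b ≠ 0 := nonZeroDivisors.ne_zero hb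
    rw [← natDegree_map_eq_of_injective (IsFractionRing.injective ℤ ℚ), h,
      ← IsScalarTower.algebraMap_smul ℚ b (minpoly ℚ α)]
    exact natDegree_smul _ (by simpa using hb0)
  have hdvd : minpoly ℚ α ∣ (intMinpoly α).map (algebraMap ℤ ℚ) := by
    apply minpoly.dvd
    rw [aeval_map_algebraMap]
    exact aeval_intMinpoly hα
  have hle : ((intMinpoly α).map (algebraMap ℤ ℚ)).natDegree ≤ (minpoly ℚ α).natDegree := by
    rw [natDegree_map_eq_of_injective (IsFractionRing.injective ℤ ℚ), hdeg]
  exact (associated_of_dvd_of_natDegree_le hdvd h0 hle).irreducible hirr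

end

/-!
Write `a = x₀`, `e = x₁ - ξ x₀`, `f = x₂ - 2ξ x₁ + ξ² x₀` for an integral point `x`. Then
`det x = a f - e²`, and the Taylor coefficients of `Q_k` at `ξ` are, up to sign, the `2 × 2` minors of the rows
`(a, e, f)` of `y_k` and `y_{k+1}`.

For an admissible sequence, `|det y_k| ≥ 1` forces `|f| ∼ Y_k⁻¹` and `|a| ∼ Y_k`, so the derivative
`Q_k'(ξ)` and the largest coefficient of `Q_k` are both `∼ Y_{k+1} / Y_k`. The main term of the
non-zero integer `det (y_k, y_{k+1}, y_{k+2})` is `y_{k+2,0} Q_k(ξ)`, whence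
`|Q_k(ξ)| ∼ (Y_k Y_{k+1})⁻¹` (`IsApproxSeq.isTheta_qVal`). So `Q_k` has one root `α_k` with
`|ξ - α_k| ∼ Y_{k+1}⁻²`, the other one staying away from `ξ` (`IsApproxSeq.exists_close_root`).
The content of `Q_k` divides the bounded determinant `det (y_k, y_{k+1}, y_{k+2})`, hence
`H(α_k) ∼ Y_{k+1} / Y_k` and `H(α_k) ^ (γ²) ∼ Y_{k+1}`
(`IsApproxSeq.exists_algHeight_rpow_bounds`). Evaluating `r + sT` and `rT + sT²` at the points `y_k`
gives `|sξ + r| ≫ |s|^{-γ}`, and this excludes rational roots of `Q_k` for large `k`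
(`IsApproxSeq.eventually_irreducible`).

For any other algebraic number `β` of degree at most `2`, let `u` be the coefficient vector of its
irreducible polynomial `P`, and let `Y_k` be of the order of `H(β)`, up to the power `γ`. If `u` is
orthogonal to `y_k` and `y_{k+1}`, then `P` is proportional to `Q_k`; otherwise
`|P(ξ)| ≫ Y_{k+1}⁻¹ ≫ H(β) ^ (-γ²)`, so `|ξ - β| ≫ H(β) ^ (-γ² - 1)`
(`IsApproxSeq.exists_le_dist`).

The sequence `y_k` itself consists of the minimal points `x_i`, in the sense of Davenport and
Schmidt, for which `x_{i-1}, x_i, x_{i+1}` are linearly independent. With `X_i = |x_{i,0}|` and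
`L_i = L(x_i)`, extremality gives `L_i ≪ X_{i+1}^{-1/γ}`; moreover `X_i L_i ≫ |det x_i| ≥ 1` for
large `i`, and `X_{i+1} L_i L_{i-1} ≫ 1` at the chosen indices. Together these force
`X_{i+1} ∼ X_i^γ`, `L_i ∼ X_i⁻¹` and `L_{i-1} ∼ X_i^{-1/γ}` there
(`log_estimates_of_independent`). Between two consecutive chosen indices the minimal points stay in
one plane, where any two successive ones form a basis of the integral points, so that
`x_i × x_{i+1}` is constant up to sign; comparing its size at both ends gives `Y_{k+1} ∼ Y_k^γ`
(`IsExtremal.exists_isApproxSeq`).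
-/

noncomputable section

/-! ### Coordinates adapted to `ξ` -/

section Coordinates

open Matrix

/-- The defect `x₁ - ξ x₀` of an integral point with respect to the curve `(1, ξ, ξ²)`. -/
def linErr (ξ : ℝ) (x : Fin 3 → ℤ) : ℝ := x 1 - ξ * x 0

/-- The second order defect `x₂ - 2ξ x₁ + ξ² x₀`: together with `x₀` and `linErr ξ x`, this is the
coordinate vector of `x` after the substitution `T = ξ + t` in `(1, T, T²)`. -/
def quadErr (ξ : ℝ) (x : Fin 3 → ℤ) : ℝ := x 2 - 2 * ξ * x 1 + ξ ^ 2 * x 0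

theorem symDet_eq_err (ξ : ℝ) (x : Fin 3 → ℤ) :
    (symDet x : ℝ) = x 0 * quadErr ξ x - linErr ξ x ^ 2 := by
  simp only [symDet, quadErr, linErr]; push_cast; ring

theorem det3_eq_dot_cross (x y z : Fin 3 → ℤ) : det3 x y z = x ⬝ᵥ crossProduct y z :=
  (triple_product_eq_det x y z).symm

theorem det3_eq_err (ξ : ℝ) (x y z : Fin 3 → ℤ) :
    (det3 x y z : ℝ) = z 0 * (linErr ξ x * quadErr ξ y - quadErr ξ x * linErr ξ y)
      + linErr ξ z * (y 0 * quadErr ξ x - x 0 * quadErr ξ y)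
      + quadErr ξ z * (x 0 * linErr ξ y - linErr ξ x * y 0) := by
  rw [det3_eq_dot_cross]
  simp only [cross_apply, vec3_dotProduct, quadErr, linErr]
  simp
  ring

theorem abs_linErr_le (ξ : ℝ) (x : Fin 3 → ℤ) : |linErr ξ x| ≤ ptL ξ x := by
  refine le_trans (le_of_eq ?_) (le_max_left _ _)
  rw [linErr, ← abs_neg]; congr 1; ring

theorem abs_quadErr_le (ξ : ℝ) (x : Fin 3 → ℤ) :
    |quadErr ξ x| ≤ (1 + 2 * |ξ|) * ptL ξ x := by
  have h : quadErr ξ x = -((x 0 : ℝ) * ξ ^ 2 - x 2) + (2 * ξ) * ((x 0 : ℝ) * ξ - x 1) := by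
    simp only [quadErr]; ring
  have h1 : |(x 0 : ℝ) * ξ ^ 2 - x 2| ≤ ptL ξ x := le_max_right _ _
  have h2 : |(x 0 : ℝ) * ξ - x 1| ≤ ptL ξ x := le_max_left _ _
  calc |quadErr ξ x| ≤ |-((x 0 : ℝ) * ξ ^ 2 - x 2)| + |(2 * ξ) * ((x 0 : ℝ) * ξ - x 1)| := by
        rw [h]; exact abs_add_le _ _
    _ = |(x 0 : ℝ) * ξ ^ 2 - x 2| + 2 * |ξ| * |(x 0 : ℝ) * ξ - x 1| := by
        rw [abs_neg, abs_mul, abs_mul, abs_two]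
    _ ≤ ptL ξ x + 2 * |ξ| * ptL ξ x := by gcongr
    _ = _ := by ring

theorem abs_coord_zero_le (x : Fin 3 → ℤ) : |(x 0 : ℝ)| ≤ ptNorm x := le_max_left _ _

theorem ptL_nonneg (ξ : ℝ) (x : Fin 3 → ℤ) : 0 ≤ ptL ξ x :=
  (abs_nonneg _).trans (le_max_left _ _)

end Coordinates

/-! ### Sizes of the coefficients of `Q_k` -/

section Asymptotics

open Filter Asymptotics Topology

theorem LessLess.isBigO {A B : ℕ → ℝ} (h : LessLess A B) (hA : ∀ k, 1 ≤ k → 0 ≤ A k)  :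
    A =O[atTop] B := by
  obtain ⟨c, hc, h⟩ := h
  refine IsBigO.of_bound c ?_
  filter_upwards [eventually_ge_atTop 1] with k hk
  rw [Real.norm_of_nonneg (hA k hk)]
  exact (h k hk).trans (by gcongr; exact Real.le_norm_self _)

theorem SameOrder.isTheta {A B : ℕ → ℝ} (h : SameOrder A B) (hA : ∀ k, 1 ≤ k → 0 ≤ A k)
    (hB : ∀ k, 1 ≤ k → 0 ≤ B k) : A =Θ[atTop] B :=
  ⟨h.1.isBigO hA, h.2.isBigO hB⟩

variable {ξ : ℝ} {Y : ℕ → ℕ} {y : ℕ → Fin 3 → ℤ}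

namespace IsApproxSeq

theorem le_seq (h : IsApproxSeq ξ Y y) (k : ℕ) : k ≤ Y k := by
  induction k with
  | zero => exact Nat.zero_le _
  | succ k ih =>
    rcases Nat.eq_zero_or_pos k with rfl | hk
    · exact h.pos 1 le_rfl
    · exact lt_of_le_of_lt ih (h.strictMono k hk)

theorem tendsto (h : IsApproxSeq ξ Y y) : Tendsto (fun k => (Y k : ℝ)) atTop atTop :=
  tendsto_natCast_atTop_atTop.comp (tendsto_atTop_mono h.le_seq tendsto_id)

theorem tendsto_succ (h : IsApproxSeq ξ Y y) :
    Tendsto (fun k => (Y (k + 1) : ℝ)) atTop atTop :=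
  h.tendsto.comp (tendsto_add_atTop_nat 1)

theorem eventually_pos (h : IsApproxSeq ξ Y y) : ∀ᶠ k in atTop, (0 : ℝ) < Y k :=
  h.tendsto.eventually_gt_atTop 0

theorem isTheta_succ (h : IsApproxSeq ξ Y y) :
    (fun k => (Y (k + 1) : ℝ)) =Θ[atTop] fun k => (Y k : ℝ) ^ Real.goldenRatio :=
  h.growth.isTheta (fun _ _ => by positivity) (fun _ _ => by positivity)

/-- Since `γ² = γ + 1`, three consecutive sizes satisfy `Y_{k+2} ∼ Y_{k+1} Y_k`. -/
theorem isTheta_succ_succ (h : IsApproxSeq ξ Y y) :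
    (fun k => (Y (k + 2) : ℝ)) =Θ[atTop] fun k => (Y (k + 1) : ℝ) * Y k := by
  have h1 : (fun k => (Y (k + 2) : ℝ)) =Θ[atTop]
      fun k => (Y (k + 1) : ℝ) ^ Real.goldenRatio :=
    ⟨h.isTheta_succ.1.comp_tendsto (tendsto_add_atTop_nat 1),
      h.isTheta_succ.2.comp_tendsto (tendsto_add_atTop_nat 1)⟩
  have hγ : 0 ≤ Real.goldenRatio - 1 := by linarith [Real.one_lt_goldenRatio]
  have h2 : (fun k => (Y (k + 1) : ℝ) ^ (Real.goldenRatio - 1)) =Θ[atTop] fun k => (Y k : ℝ) := by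
    have h3 := h.isTheta_succ.rpow (r := Real.goldenRatio - 1)
      (Eventually.of_forall fun k => by simp)
      (Eventually.of_forall fun k => by simp only [Pi.zero_apply]; positivity)
    refine h3.trans_eventuallyEq (Eventually.of_forall fun k => ?_)
    have h4 : Real.goldenRatio * (Real.goldenRatio - 1) = 1 := by
      linarith [Real.goldenRatio_sq]
    change ((Y k : ℝ) ^ Real.goldenRatio) ^ (Real.goldenRatio - 1) = Y k
    rw [← Real.rpow_mul (Nat.cast_nonneg _), h4, Real.rpow_one]
  refine h1.trans (EventuallyEq.trans_isTheta ?_ ((isTheta_refl _ _).mul h2))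
  filter_upwards [h.tendsto_succ.eventually_gt_atTop 0] with k hk
  rw [← Real.rpow_one_add' hk.le (by linarith)]; congr 1; ring

theorem isBigO_coord (h : IsApproxSeq ξ Y y) :
    (fun k => (y k 0 : ℝ)) =O[atTop] fun k => (Y k : ℝ) := by
  have h1 := h.norm.isTheta (fun k _ => (abs_nonneg _).trans (abs_coord_zero_le (y k)))
    (fun _ _ => by positivity)
  refine IsBigO.trans (IsBigO.of_norm_le fun k => ?_) h1.1
  exact abs_coord_zero_le (y k)

theorem isBigO_ptL (h : IsApproxSeq ξ Y y) :
    (fun k => ptL ξ (y k)) =O[atTop] fun k => (Y k : ℝ)⁻¹ :=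
  (h.approx.isTheta (fun k _ => ptL_nonneg ξ (y k)) (fun _ _ => by positivity)).1

theorem isBigO_linErr (h : IsApproxSeq ξ Y y) :
    (fun k => linErr ξ (y k)) =O[atTop] fun k => (Y k : ℝ)⁻¹ :=
  (IsBigO.of_norm_le fun k => abs_linErr_le ξ (y k)).trans h.isBigO_ptL

theorem isBigO_quadErr (h : IsApproxSeq ξ Y y) :
    (fun k => quadErr ξ (y k)) =O[atTop] fun k => (Y k : ℝ)⁻¹ :=
  (IsBigO.of_norm_le fun k => abs_quadErr_le ξ (y k)).trans (h.isBigO_ptL.const_mul_left _)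

theorem isLittleO_inv (h : IsApproxSeq ξ Y y) :
    (fun k => (Y k : ℝ)⁻¹) =o[atTop] fun _ => (1 : ℝ) :=
  (isLittleO_one_iff ℝ).2 h.tendsto.inv_tendsto_atTop

/-- As `symDet y_k = y_{k,0} · quadErr - linErr²` is bounded away from `0`, so is the first
product. -/
theorem one_isBigO_mul (h : IsApproxSeq ξ Y y) :
    (fun _ => (1 : ℝ)) =O[atTop] fun k => (y k 0 : ℝ) * quadErr ξ (y k) := by
  have h1 : (fun k => linErr ξ (y k)) =o[atTop] fun _ => (1 : ℝ) :=
    h.isBigO_linErr.trans_isLittleO h.isLittleO_inv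
  have h2 := h1.def (show (0 : ℝ) < 1 / 2 by norm_num)
  refine IsBigO.of_bound 2 ?_
  filter_upwards [h2, eventually_ge_atTop 1] with k hk hk1
  have h3 : (1 : ℝ) ≤ |(symDet (y k) : ℝ)| := by exact_mod_cast h.one_le_symDet k hk1
  rw [symDet_eq_err ξ] at h3
  have h4 := h3.trans (abs_sub _ _)
  rw [abs_pow] at h4
  simp only [norm_one, mul_one, Real.norm_eq_abs] at hk ⊢
  nlinarith [abs_nonneg (linErr ξ (y k))]

theorem isTheta_coord (h : IsApproxSeq ξ Y y) :
    (fun k => (y k 0 : ℝ)) =Θ[atTop] fun k => (Y k : ℝ) := by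
  refine ⟨h.isBigO_coord, ?_⟩
  have h1 := (isBigO_refl (fun k => (Y k : ℝ)) atTop).mul
    (h.one_isBigO_mul.trans ((isBigO_refl (fun k => (y k 0 : ℝ)) atTop).mul h.isBigO_quadErr))
  refine h1.congr' (by simp) ?_
  filter_upwards [h.eventually_pos] with k hk
  field_simp

theorem isTheta_quadErr (h : IsApproxSeq ξ Y y) :
    (fun k => quadErr ξ (y k)) =Θ[atTop] fun k => (Y k : ℝ)⁻¹ := by
  refine ⟨h.isBigO_quadErr, ?_⟩
  have h1 := (isBigO_refl (fun k => (Y k : ℝ)⁻¹) atTop).mul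
    (h.one_isBigO_mul.trans (h.isBigO_coord.mul (isBigO_refl (fun k => quadErr ξ (y k)) atTop)))
  refine h1.congr' (by simp) ?_
  filter_upwards [h.eventually_pos] with k hk
  field_simp

end IsApproxSeq

/-- The value at `ξ` of `Q_k`, in terms of the defects. -/
def qVal (ξ : ℝ) (y : ℕ → Fin 3 → ℤ) (k : ℕ) : ℝ :=
  linErr ξ (y k) * quadErr ξ (y (k + 1)) - quadErr ξ (y k) * linErr ξ (y (k + 1))

/-- The derivative at `ξ` of `Q_k`, in terms of the defects. -/
def qDeriv (ξ : ℝ) (y : ℕ → Fin 3 → ℤ) (k : ℕ) : ℝ :=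
  y (k + 1) 0 * quadErr ξ (y k) - y k 0 * quadErr ξ (y (k + 1))

/-- The coefficient of `T ^ 2` in `Q_k`, in terms of the defects. -/
def qLead (ξ : ℝ) (y : ℕ → Fin 3 → ℤ) (k : ℕ) : ℝ :=
  y k 0 * linErr ξ (y (k + 1)) - linErr ξ (y k) * y (k + 1) 0

theorem isBigO_comp_succ {u v : ℕ → ℝ} (h : u =O[atTop] v) :
    (fun k => u (k + 1)) =O[atTop] fun k => v (k + 1) :=
  h.comp_tendsto (tendsto_add_atTop_nat 1)

namespace IsApproxSeq

theorem isLittleO_succ (h : IsApproxSeq ξ Y y) :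
    (fun k => (Y k : ℝ)) =o[atTop] fun k => (Y (k + 1) : ℝ) := by
  have h1 : (fun k => (Y k : ℝ)) =o[atTop] fun k => (Y k : ℝ) ^ Real.goldenRatio := by
    have hγ : 0 < Real.goldenRatio - 1 := by linarith [Real.one_lt_goldenRatio]
    have h2 : (fun _ => (1 : ℝ)) =o[atTop] fun k => (Y k : ℝ) ^ (Real.goldenRatio - 1) :=
      (isLittleO_one_left_iff ℝ).2
        (tendsto_norm_atTop_atTop.comp ((tendsto_rpow_atTop hγ).comp h.tendsto))
    refine ((isBigO_refl (fun k => (Y k : ℝ)) atTop).mul_isLittleO h2).congr' (by simp) ?_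
    filter_upwards [h.eventually_pos] with k hk
    rw [← Real.rpow_one_add' hk.le (by linarith)]; congr 1; ring
  exact h1.trans_isTheta h.isTheta_succ.symm

theorem isTheta_qDeriv (h : IsApproxSeq ξ Y y) :
    qDeriv ξ y =Θ[atTop] fun k => (Y (k + 1) : ℝ) * (Y k : ℝ)⁻¹ := by
  have h1 : (fun k => (y (k + 1) 0 : ℝ) * quadErr ξ (y k)) =Θ[atTop]
      fun k => (Y (k + 1) : ℝ) * (Y k : ℝ)⁻¹ :=
    IsTheta.mul ⟨isBigO_comp_succ h.isTheta_coord.1, isBigO_comp_succ h.isTheta_coord.2⟩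
      h.isTheta_quadErr
  have h2 : (fun k => -((y k 0 : ℝ) * quadErr ξ (y (k + 1)))) =O[atTop]
      fun k => (Y k : ℝ) * (Y (k + 1) : ℝ)⁻¹ :=
    (h.isBigO_coord.mul (isBigO_comp_succ h.isBigO_quadErr)).neg_left
  have h3 : (fun k => (Y k : ℝ) * (Y (k + 1) : ℝ)⁻¹) =o[atTop]
      fun k => (Y (k + 1) : ℝ) * (Y k : ℝ)⁻¹ := by
    refine h.isLittleO_succ.mul_isBigO (h.isLittleO_succ.isBigO.inv_rev ?_)
    filter_upwards [h.eventually_pos] with k hk hk0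
    exact absurd hk0 hk.ne'
  have h4 := h1.add_isLittleO (h2.trans_isLittleO h3)
  refine EventuallyEq.trans_isTheta (Eventually.of_forall fun k => ?_) h4
  simp only [qDeriv, Pi.add_apply]; ring

theorem isBigO_qLead (h : IsApproxSeq ξ Y y) :
    qLead ξ y =O[atTop] fun k => (Y (k + 1) : ℝ) * (Y k : ℝ)⁻¹ := by
  have h1 : (fun k => (y k 0 : ℝ) * linErr ξ (y (k + 1))) =O[atTop]
      fun k => (Y (k + 1) : ℝ) * (Y k : ℝ)⁻¹ := by
    refine (h.isBigO_coord.mul (isBigO_comp_succ h.isBigO_linErr)).trans ?_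
    refine h.isLittleO_succ.isBigO.mul (h.isLittleO_succ.isBigO.inv_rev ?_)
    filter_upwards [h.eventually_pos] with k hk hk0
    exact absurd hk0 hk.ne'
  have h2 := h.isBigO_linErr.mul (isBigO_comp_succ h.isBigO_coord)
  exact h1.sub (h2.congr_right fun k => mul_comm _ _)

theorem isBigO_qVal (h : IsApproxSeq ξ Y y) :
    qVal ξ y =O[atTop] fun k => (Y (k + 1) : ℝ)⁻¹ * (Y k : ℝ)⁻¹ := by
  have h1 := h.isBigO_linErr.mul (isBigO_comp_succ h.isBigO_quadErr)
  have h2 := h.isBigO_quadErr.mul (isBigO_comp_succ h.isBigO_linErr)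
  exact (h1.sub h2).congr_right fun k => mul_comm _ _

/-- `y_{k+2,0} Q_k(ξ)` is the main term of `det (y_k, y_{k+1}, y_{k+2})`, which is a non-zero
integer. -/
theorem isTheta_qVal (h : IsApproxSeq ξ Y y) :
    qVal ξ y =Θ[atTop] fun k => (Y (k + 1) : ℝ)⁻¹ * (Y k : ℝ)⁻¹ := by
  refine ⟨h.isBigO_qVal, ?_⟩
  have hs : ∀ {u v : ℕ → ℝ}, u =O[atTop] v → (fun k => u (k + 2)) =O[atTop] fun k => v (k + 2) :=
    fun hu => hu.comp_tendsto (tendsto_add_atTop_nat 2)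
  have h2 : (fun k => linErr ξ (y (k + 2)) * qDeriv ξ y k + quadErr ξ (y (k + 2)) * qLead ξ y k)
      =o[atTop] fun _ => (1 : ℝ) := by
    have h3 := ((hs h.isBigO_linErr).mul h.isTheta_qDeriv.1).add
      ((hs h.isBigO_quadErr).mul h.isBigO_qLead)
    have h4 : (fun k => (Y (k + 2) : ℝ)⁻¹ * ((Y (k + 1) : ℝ) * (Y k : ℝ)⁻¹)) =o[atTop]
        fun _ => (1 : ℝ) := by
      have h5 : (fun k => (Y (k + 2) : ℝ)⁻¹ * ((Y (k + 1) : ℝ) * (Y k : ℝ)⁻¹)) =O[atTop]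
          fun k => (Y k : ℝ)⁻¹ * (Y k : ℝ)⁻¹ := by
        refine (h.isTheta_succ_succ.inv.mul (isTheta_refl _ _)).1.congr' EventuallyEq.rfl ?_
        filter_upwards [h.tendsto_succ.eventually_gt_atTop 0, h.eventually_pos] with k hk hk'
        field_simp
      refine h5.trans_isLittleO ?_
      simpa using h.isLittleO_inv.mul h.isLittleO_inv
    exact h3.trans_isLittleO h4
  have h3 : (fun _ => (1 : ℝ)) =O[atTop] fun k => (y (k + 2) 0 : ℝ) * qVal ξ y k := by
    refine IsBigO.of_bound 2 ?_
    filter_upwards [h2.def (show (0 : ℝ) < 1 / 2 by norm_num), eventually_ge_atTop 1] with k hk hk1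
    have h4 : (1 : ℝ) ≤ |(det3 (y k) (y (k + 1)) (y (k + 2)) : ℝ)| := by
      exact_mod_cast h.one_le_det3 k hk1
    have h5 : (det3 (y k) (y (k + 1)) (y (k + 2)) : ℝ) = y (k + 2) 0 * qVal ξ y k +
        (linErr ξ (y (k + 2)) * qDeriv ξ y k + quadErr ξ (y (k + 2)) * qLead ξ y k) := by
      rw [det3_eq_err ξ, qVal, qDeriv, qLead]; ring
    rw [h5] at h4
    have h6 := h4.trans (abs_add_le _ _)
    simp only [norm_one, mul_one, Real.norm_eq_abs] at hk ⊢
    linarith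
  have h4 := (isBigO_refl (fun k => (Y (k + 1) : ℝ)⁻¹ * (Y k : ℝ)⁻¹) atTop).mul
    (h3.trans (((hs h.isBigO_coord).trans h.isTheta_succ_succ.1).mul
      (isBigO_refl (qVal ξ y) atTop)))
  refine h4.congr' (by simp) ?_
  filter_upwards [h.tendsto_succ.eventually_gt_atTop 0, h.eventually_pos] with k hk hk'
  field_simp

end IsApproxSeq

end Asymptotics

/-! ### An irrationality measure for `ξ` -/

section LinearForms

open Filter Asymptotics Topology

variable {ξ : ℝ} {Y : ℕ → ℕ} {y : ℕ → Fin 3 → ℤ}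

/-- Uniform upper bounds for the coordinates and the defects of the points `y_k`. -/
theorem IsApproxSeq.exists_bounds (h : IsApproxSeq ξ Y y) :
    ∃ K : ℝ, 0 < K ∧ ∀ᶠ k in atTop,
      |(y k 0 : ℝ)| ≤ K * Y k ∧ |(y k 1 : ℝ)| ≤ K * Y k ∧
      |(y k 1 : ℝ) - ξ * y k 0| ≤ K * (Y k : ℝ)⁻¹ ∧ |(y k 2 : ℝ) - ξ * y k 1| ≤ K * (Y k : ℝ)⁻¹ ∧
      |(y k 2 : ℝ) - ξ ^ 2 * y k 0| ≤ K * (Y k : ℝ)⁻¹ := by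
  have hinv : (fun k => (Y k : ℝ)⁻¹) =O[atTop] fun k => (Y k : ℝ) :=
    h.isLittleO_inv.isBigO.trans
      ((isLittleO_one_left_iff ℝ).2 (tendsto_norm_atTop_atTop.comp h.tendsto)).isBigO
  have h1 : (fun k => (y k 1 : ℝ)) =O[atTop] fun k => (Y k : ℝ) :=
    ((h.isBigO_linErr.trans hinv).add (h.isBigO_coord.const_mul_left ξ)).congr_left
      fun k => by simp only [linErr]; ring
  have h2 : (fun k => (y k 2 : ℝ) - ξ * y k 1) =O[atTop] fun k => (Y k : ℝ)⁻¹ :=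
    (h.isBigO_quadErr.add (h.isBigO_linErr.const_mul_left ξ)).congr_left
      fun k => by simp only [linErr, quadErr]; ring
  have h3 : (fun k => (y k 2 : ℝ) - ξ ^ 2 * y k 0) =O[atTop] fun k => (Y k : ℝ)⁻¹ :=
    (h.isBigO_quadErr.add (h.isBigO_linErr.const_mul_left (2 * ξ))).congr_left
      fun k => by simp only [linErr, quadErr]; ring
  have key : ∀ {u v : ℕ → ℝ}, u =O[atTop] v → (∀ k, 0 ≤ v k) →
      ∀ᶠ K : ℝ in atTop, ∀ᶠ k in atTop, |u k| ≤ K * v k := by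
    intro u v huv hv
    obtain ⟨c, hc⟩ := huv.bound
    filter_upwards [eventually_ge_atTop c] with K hK
    filter_upwards [hc] with k hk
    rw [Real.norm_eq_abs, Real.norm_of_nonneg (hv k)] at hk
    exact hk.trans (by gcongr; exact hv k)
  have hY : ∀ k, (0 : ℝ) ≤ Y k := fun k => Nat.cast_nonneg _
  have hY' : ∀ k, (0 : ℝ) ≤ (Y k : ℝ)⁻¹ := fun k => inv_nonneg.2 (hY k)
  obtain ⟨K, hK, k0, k1, k2, k3, k4⟩ := ((eventually_gt_atTop (0 : ℝ)).and
    ((key h.isBigO_coord hY).and ((key h1 hY).and ((key h.isBigO_linErr hY').and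
      ((key h2 hY').and (key h3 hY')))))).exists
  exact ⟨K, hK, by filter_upwards [k0, k1, k2, k3, k4] with k a b c d e using ⟨a, b, c, d, e⟩⟩

/-- Every scale `B x` with `x ≥ 1` is reached by some `Y_k` which is `≪ x ^ γ`, because of
`Y_{k+1} ≪ Y_k ^ γ`. -/
theorem IsApproxSeq.exists_scale (h : IsApproxSeq ξ Y y) {B : ℝ} (hB : 0 < B) (k₀ : ℕ) :
    ∃ D : ℝ, 0 < D ∧ ∀ x : ℝ, 1 ≤ x →
      ∃ k, k₀ ≤ k ∧ B * x ≤ Y k ∧ (Y k : ℝ) ≤ D * x ^ Real.goldenRatio := by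
  obtain ⟨c, hc, hgrow⟩ := h.growth.1
  have hγ := Real.goldenRatio_pos
  let k₁ := max k₀ 1
  refine ⟨Y k₁ + c * B ^ Real.goldenRatio, by positivity, fun x hx => ?_⟩
  have hx0 : 0 < x := by linarith
  have hx1 : 1 ≤ x ^ Real.goldenRatio := Real.one_le_rpow hx hγ.le
  have hex : ∃ k, k₁ ≤ k ∧ B * x ≤ Y k :=
    ((eventually_ge_atTop k₁).and (h.tendsto.eventually_ge_atTop (B * x))).exists
  classical
  obtain ⟨hk1, hk2⟩ := Nat.find_spec hex
  have hmin := fun {m} => Nat.find_min hex (m := m)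
  generalize Nat.find hex = k at hk1 hk2 hmin ⊢
  refine ⟨k, (le_max_left _ _).trans hk1, hk2, ?_⟩
  rcases hk1.eq_or_lt with hk | hk
  · rw [← hk, add_mul]
    have h1 : (0 : ℝ) ≤ c * B ^ Real.goldenRatio * x ^ Real.goldenRatio := by positivity
    nlinarith [(Nat.cast_nonneg (Y k₁) : (0 : ℝ) ≤ Y k₁)]
  · obtain ⟨m, rfl⟩ : ∃ m, k = m + 1 := ⟨k - 1, by omega⟩
    have h1 : k₁ ≤ m := Nat.lt_succ_iff.1 hk
    have h2 : (Y m : ℝ) < B * x := by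
      by_contra hcon
      exact hmin (Nat.lt_succ_self m) ⟨h1, not_lt.1 hcon⟩
    calc (Y (m + 1) : ℝ) ≤ c * (Y m : ℝ) ^ Real.goldenRatio :=
          hgrow m ((le_max_right _ _).trans h1)
      _ ≤ c * (B * x) ^ Real.goldenRatio := by gcongr
      _ = c * B ^ Real.goldenRatio * x ^ Real.goldenRatio := by
          rw [Real.mul_rpow hB.le hx0.le]; ring
      _ ≤ _ := by gcongr; simp

/-- An irrationality measure for `ξ`. As `symDet y_k ≠ 0`, the integers `r y₀ + s y₁` and
`r y₁ + s y₂` do not both vanish at `y_k`; the bound follows with `Y_k` of the order of `|s|`. -/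
theorem IsApproxSeq.exists_le_linear_form (h : IsApproxSeq ξ Y y) :
    ∃ c : ℝ, 0 < c ∧ ∀ s r : ℤ, s ≠ 0 →
      c ≤ |(s : ℝ) * ξ + r| * |(s : ℝ)| ^ Real.goldenRatio := by
  obtain ⟨K, hK, hev⟩ := h.exists_bounds
  obtain ⟨k₀, hk₀⟩ := eventually_atTop.1 (hev.and (h.eventually_pos.and (eventually_ge_atTop 1)))
  obtain ⟨D, hD, hsc⟩ := h.exists_scale (B := 2 * K) (by positivity) k₀
  refine ⟨1 / (2 * K * D), by positivity, fun s r hs => ?_⟩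
  have hs1 : (1 : ℝ) ≤ |(s : ℝ)| := by exact_mod_cast Int.one_le_abs hs
  obtain ⟨k, hk, hlow, hup⟩ := hsc _ hs1
  obtain ⟨⟨b0, b1, b2, b3, -⟩, hpos, hk1⟩ := hk₀ k hk
  have hkey : 1 ≤ K * Y k * |(s : ℝ) * ξ + r| + |(s : ℝ)| * (K * (Y k : ℝ)⁻¹) := by
    have hbd : ∀ (a b : ℤ), r * a + s * b ≠ 0 → |(a : ℝ)| ≤ K * Y k →
        |(b : ℝ) - ξ * a| ≤ K * (Y k : ℝ)⁻¹ →
        1 ≤ K * Y k * |(s : ℝ) * ξ + r| + |(s : ℝ)| * (K * (Y k : ℝ)⁻¹) := by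
      intro a b hne ha hb
      have h1 : (1 : ℝ) ≤ |((r * a + s * b : ℤ) : ℝ)| := by exact_mod_cast Int.one_le_abs hne
      have h2 : ((r * a + s * b : ℤ) : ℝ) = a * (s * ξ + r) + s * (b - ξ * a) := by
        push_cast; ring
      calc (1 : ℝ) ≤ |(a : ℝ) * (s * ξ + r) + s * (b - ξ * a)| := by rw [← h2]; exact h1
        _ ≤ |(a : ℝ)| * |(s : ℝ) * ξ + r| + |(s : ℝ)| * |(b : ℝ) - ξ * a| := by
          rw [← abs_mul, ← abs_mul]; exact abs_add_le _ _
        _ ≤ _ := by gcongr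
    by_cases h0 : r * y k 0 + s * y k 1 = 0
    · refine hbd (y k 1) (y k 2) (fun h1 => ?_) b1 b3
      have h2 : s * symDet (y k) = 0 := by
        simp only [symDet]; linear_combination y k 0 * h1 - y k 1 * h0
      have h3 := h.one_le_symDet k hk1
      rcases mul_eq_zero.1 h2 with h4 | h4
      · exact hs h4
      · rw [h4] at h3; norm_num at h3
    · exact hbd _ _ h0 b0 b2
  have h1 : |(s : ℝ)| * (K * (Y k : ℝ)⁻¹) ≤ 1 / 2 := by
    rw [← mul_assoc, ← div_eq_mul_inv, div_le_iff₀ hpos]; linarith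
  have h2 : K * Y k * |(s : ℝ) * ξ + r| ≤
      K * (D * |(s : ℝ)| ^ Real.goldenRatio) * |(s : ℝ) * ξ + r| := by gcongr
  rw [div_le_iff₀ (by positivity)]
  linarith

end LinearForms

/-! ### Irreducibility of `Q_k` -/

section QuadraticPolynomials

open Filter Asymptotics Topology

variable {ξ : ℝ} {Y : ℕ → ℕ} {y : ℕ → Fin 3 → ℤ}

/-- The coefficients of `Q_k` are the coordinates of `y_k × y_{k+1}`. -/
theorem Qpoly_eq (y : ℕ → Fin 3 → ℤ) (k : ℕ) :
    Qpoly y k = C (crossProduct (y k) (y (k + 1)) 2) * X ^ 2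
      + C (crossProduct (y k) (y (k + 1)) 1) * X + C (crossProduct (y k) (y (k + 1)) 0) := by
  rw [Qpoly, Matrix.det_fin_three]
  simp [cross_apply]
  ring

theorem cross_two_eq (ξ : ℝ) (y : ℕ → Fin 3 → ℤ) (k : ℕ) :
    (crossProduct (y k) (y (k + 1)) 2 : ℝ) = qLead ξ y k := by
  simp [cross_apply, qLead, linErr]; ring

theorem cross_one_eq (ξ : ℝ) (y : ℕ → Fin 3 → ℤ) (k : ℕ) :
    (crossProduct (y k) (y (k + 1)) 1 : ℝ) = qDeriv ξ y k - 2 * ξ * qLead ξ y k := by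
  simp [cross_apply, qLead, qDeriv, linErr, quadErr]; ring

theorem cross_zero_eq (ξ : ℝ) (y : ℕ → Fin 3 → ℤ) (k : ℕ) :
    (crossProduct (y k) (y (k + 1)) 0 : ℝ)
      = qVal ξ y k - ξ * qDeriv ξ y k + ξ ^ 2 * qLead ξ y k := by
  simp [cross_apply, qLead, qDeriv, qVal, linErr, quadErr]; ring

/-- The Taylor expansion of `Q_k` at `ξ`. -/
theorem aeval_Qpoly (ξ : ℝ) (y : ℕ → Fin 3 → ℤ) (k : ℕ) (β : ℂ) :
    aeval β (Qpoly y k) = qVal ξ y k + qDeriv ξ y k * (β - ξ) + qLead ξ y k * (β - ξ) ^ 2 := by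
  have h0 := congrArg (fun x : ℝ => (x : ℂ)) (cross_zero_eq ξ y k)
  have h1 := congrArg (fun x : ℝ => (x : ℂ)) (cross_one_eq ξ y k)
  have h2 := congrArg (fun x : ℝ => (x : ℂ)) (cross_two_eq ξ y k)
  push_cast at h0 h1 h2
  rw [Qpoly_eq]
  simp only [map_add, map_mul, map_pow, aeval_X, aeval_C, algebraMap_int_eq, Int.coe_castRingHom]
  rw [h0, h1, h2]; ring

/-- A rational root `p / q` splits an integral quadratic polynomial over `ℤ`. -/
theorem exists_factor_of_rat_root {a b c : ℤ} {z : ℚ} (h : a * z ^ 2 + b * z + c = 0) :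
    ∃ p q u v : ℤ, a = q * u ∧ b = q * v - p * u ∧ c = -(p * v) := by
  have hq : (z.den : ℤ) ≠ 0 := by exact_mod_cast z.den_ne_zero
  have hcop : IsCoprime (z.den : ℤ) z.num := (Rat.isCoprime_num_den z).symm
  have h1 : a * z.num ^ 2 + b * z.num * z.den + c * (z.den : ℤ) ^ 2 = 0 := by
    have hz : z * z.den = z.num := Rat.mul_den_eq_num z
    have : ((a * z.num ^ 2 + b * z.num * z.den + c * (z.den : ℤ) ^ 2 : ℤ) : ℚ) = 0 := by
      push_cast; rw [← hz]; linear_combination (z.den : ℚ) ^ 2 * h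
    exact_mod_cast this
  obtain ⟨u, rfl⟩ : (z.den : ℤ) ∣ a := by
    refine (hcop.pow_right (n := 2)).dvd_of_dvd_mul_right ⟨-(b * z.num + c * z.den), ?_⟩
    linear_combination h1
  have h2 : u * z.num ^ 2 + b * z.num + c * z.den = 0 := by
    refine mul_left_cancel₀ hq ?_
    linear_combination h1
  obtain ⟨v, hv⟩ : (z.den : ℤ) ∣ b + z.num * u := by
    refine hcop.dvd_of_dvd_mul_left ⟨-c, ?_⟩
    linear_combination h2
  refine ⟨z.num, z.den, u, v, rfl, by linarith, mul_left_cancel₀ hq ?_⟩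
  linear_combination h2 - z.num * hv

/-- The size of the coefficients of `Q_k`, raised to the power `γ`, is `∼ Y_k`. -/
theorem IsApproxSeq.isTheta_ratio_rpow (h : IsApproxSeq ξ Y y) :
    (fun k => ((Y (k + 1) : ℝ) * (Y k : ℝ)⁻¹) ^ Real.goldenRatio) =Θ[atTop]
      fun k => (Y k : ℝ) := by
  have h1 : (fun k => (Y (k + 1) : ℝ) * (Y k : ℝ)⁻¹) =Θ[atTop]
      fun k => (Y k : ℝ) ^ (Real.goldenRatio - 1) := by
    refine (h.isTheta_succ.mul (isTheta_refl (fun k => (Y k : ℝ)⁻¹) _)).trans_eventuallyEq ?_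
    filter_upwards [h.eventually_pos] with k hk
    rw [Real.rpow_sub_one hk.ne', div_eq_mul_inv]
  refine (h1.rpow (r := Real.goldenRatio) (Eventually.of_forall fun k => ?_)
    (Eventually.of_forall fun k => ?_)).trans_eventuallyEq (Eventually.of_forall fun k => ?_)
  · simp only [Pi.zero_apply]; positivity
  · simp only [Pi.zero_apply]; positivity
  · have h4 : (Real.goldenRatio - 1) * Real.goldenRatio = 1 := by
      linarith [Real.goldenRatio_sq]
    change ((Y k : ℝ) ^ (Real.goldenRatio - 1)) ^ Real.goldenRatio = Y k
    rw [← Real.rpow_mul (Nat.cast_nonneg _), h4, Real.rpow_one]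

theorem IsApproxSeq.tendsto_qVal_mul (h : IsApproxSeq ξ Y y) {w : ℕ → ℝ}
    (hw : w =O[atTop] fun k => (Y (k + 1) : ℝ) * (Y k : ℝ)⁻¹) :
    Tendsto (fun k => |qVal ξ y k| * |w k| ^ Real.goldenRatio) atTop (𝓝 0) := by
  have h1 : (fun k => |w k| ^ Real.goldenRatio) =O[atTop] fun k => (Y k : ℝ) :=
    (IsBigO.rpow Real.goldenRatio_pos.le (Eventually.of_forall fun k => by
      simp only [Pi.zero_apply]; positivity) hw.abs_left).trans h.isTheta_ratio_rpow.1
  have h2 := (h.isBigO_qVal.abs_left.mul h1).trans_isLittleO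
    (g := fun k => (Y (k + 1) : ℝ)⁻¹ * (Y k : ℝ)⁻¹ * Y k) (k := fun _ => (1 : ℝ)) ?_
  · exact (isLittleO_one_iff ℝ).1 h2
  · refine ((isLittleO_one_iff ℝ).2 h.tendsto_succ.inv_tendsto_atTop).congr' ?_ EventuallyEq.rfl
    filter_upwards [h.eventually_pos] with k hk
    simp only [Pi.inv_apply]
    field_simp

/-- For large `k` the polynomial `Q_k` takes too small a value at `ξ` to be linear or a product of
linear factors, in view of the irrationality measure of `ξ`. -/
theorem IsApproxSeq.eventually_irreducible (h : IsApproxSeq ξ Y y) :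
    ∀ᶠ k in atTop, Irreducible ((Qpoly y k).map (Int.castRingHom ℚ)) ∧
      (Qpoly y k).natDegree = 2 := by
  obtain ⟨c, hc, hlin⟩ := h.exists_le_linear_form
  have hO1 : (fun k => (crossProduct (y k) (y (k + 1)) 1 : ℝ)) =O[atTop]
      fun k => (Y (k + 1) : ℝ) * (Y k : ℝ)⁻¹ :=
    (h.isTheta_qDeriv.1.sub (h.isBigO_qLead.const_mul_left (2 * ξ))).congr_left
      fun k => (cross_one_eq ξ y k).symm
  have hO2 : (fun k => (crossProduct (y k) (y (k + 1)) 2 : ℝ)) =O[atTop]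
      fun k => (Y (k + 1) : ℝ) * (Y k : ℝ)⁻¹ :=
    h.isBigO_qLead.congr_left fun k => (cross_two_eq ξ y k).symm
  have hne : ∀ᶠ k in atTop, qDeriv ξ y k ≠ 0 := by
    filter_upwards [h.isTheta_qDeriv.eq_zero_iff, h.eventually_pos,
      h.tendsto_succ.eventually_gt_atTop 0] with k hk hk1 hk2 h0
    exact absurd (hk.1 h0) (by positivity)
  filter_upwards [hne, (h.tendsto_qVal_mul hO1).eventually_lt_const hc,
    (h.tendsto_qVal_mul hO2).eventually_lt_const (pow_pos hc 2)] with k hk hk1 hk2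
  have e0 := cross_zero_eq ξ y k
  have e1 := cross_one_eq ξ y k
  have e2 := cross_two_eq ξ y k
  have hQ := Qpoly_eq y k
  set w := crossProduct (y k) (y (k + 1)) with hw
  have hval : qVal ξ y k = w 0 + w 1 * ξ + w 2 * ξ ^ 2 := by rw [e0, e1, e2]; ring
  have hw2 : w 2 ≠ 0 := by
    intro h0
    have h0' : qLead ξ y k = 0 := by rw [← e2, h0, Int.cast_zero]
    have hw1 : w 1 ≠ 0 := by
      intro h1
      rw [h1, h0', Int.cast_zero] at e1
      exact hk (by linarith)
    have h1 := hlin (w 1) (w 0) hw1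
    rw [hval, h0, Int.cast_zero, zero_mul, add_zero, add_comm, mul_comm (w 1 : ℝ) ξ] at hk1
    rw [mul_comm (w 1 : ℝ) ξ] at h1
    linarith
  have hdeg : (Qpoly y k).natDegree = 2 := by rw [hQ]; exact natDegree_quadratic hw2
  refine ⟨?_, hdeg⟩
  have hdeg' : ((Qpoly y k).map (Int.castRingHom ℚ)).natDegree = 2 := by
    rw [natDegree_map_eq_of_injective (RingHom.injective_int _), hdeg]
  refine (irreducible_iff_roots_eq_zero_of_degree_le_three hdeg'.ge
    (by rw [hdeg']; norm_num)).2 (Multiset.eq_zero_of_forall_notMem fun z hz => ?_)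
  have hz' : (w 2 : ℚ) * z ^ 2 + w 1 * z + w 0 = 0 := by
    have := (mem_roots'.1 hz).2
    rw [hQ] at this
    simpa [IsRoot] using this
  obtain ⟨p, q, u, v, h2, h1, h0⟩ := exists_factor_of_rat_root hz'
  have hq : q ≠ 0 := by rintro rfl; simp at h2; exact hw2 h2
  have hu : u ≠ 0 := by rintro rfl; simp at h2; exact hw2 h2
  have hfac : qVal ξ y k = (q * ξ + (-p : ℤ)) * (u * ξ + v) := by
    rw [hval, h2, h1, h0]; push_cast; ring
  have hprod := mul_le_mul (hlin q (-p) hq) (hlin u v hu) hc.le (by positivity)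
  rw [hfac, h2] at hk2
  push_cast at hk2 hprod
  rw [abs_mul, abs_mul, Real.mul_rpow (abs_nonneg _) (abs_nonneg _)] at hk2
  nlinarith

end QuadraticPolynomials

/-! ### Heights and contents -/

section Heights

theorem natDegree_intMinpoly {α : ℂ} (hα : IsAlgebraic ℚ α) :
    (intMinpoly α).natDegree = (minpoly ℚ α).natDegree := by
  have hp : (intMinpoly α).IsPrimitive := isPrimitive_primPart _
  have hirr : Irreducible ((intMinpoly α).map (algebraMap ℤ ℚ)) :=
    (hp.irreducible_iff_irreducible_map_fraction_map (K := ℚ)).1 (irreducible_intMinpoly hα)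
  have hdvd : minpoly ℚ α ∣ (intMinpoly α).map (algebraMap ℤ ℚ) := by
    apply minpoly.dvd
    rw [aeval_map_algebraMap]
    exact aeval_intMinpoly hα
  have hass := (minpoly.irreducible hα.isIntegral).associated_of_dvd hirr hdvd
  rw [natDegree_eq_of_degree_eq (degree_eq_degree_of_associated hass),
    natDegree_map_eq_of_injective (IsFractionRing.injective ℤ ℚ)]

theorem one_le_algHeight {α : ℂ} (hα : IsAlgebraic ℚ α) : 1 ≤ algHeight α := by
  have h0 : (intMinpoly α).leadingCoeff ≠ 0 :=
    leadingCoeff_ne_zero.2 (irreducible_intMinpoly hα).ne_zero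
  refine le_trans ?_ (le_supNorm _ (intMinpoly α).natDegree)
  rw [Int.norm_eq_abs]
  exact_mod_cast Int.one_le_abs h0

/-- An integral polynomial which is irreducible over `ℚ` is, up to its content, the irreducible
polynomial over `ℤ` of each of its roots. -/
theorem exists_eq_C_mul_intMinpoly {Q : ℤ[X]} (hQ : Irreducible (Q.map (Int.castRingHom ℚ)))
    {β : ℂ} (hβ : aeval β Q = 0) : ∃ n : ℤ, n ≠ 0 ∧ Q = C n * intMinpoly β := by
  have hQ0 : Q ≠ 0 := by rintro rfl; simp at hQ
  have hQβ : aeval β (Q.map (Int.castRingHom ℚ)) = 0 := by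
    rw [← algebraMap_int_eq, aeval_map_algebraMap]; exact hβ
  have halg : IsAlgebraic ℚ β := ⟨_, hQ.ne_zero, hQβ⟩
  have hp : (intMinpoly β).IsPrimitive := isPrimitive_primPart _
  have hass := (minpoly.irreducible halg.isIntegral).associated_of_dvd hQ (minpoly.dvd _ _ hQβ)
  have hdeg : Q.natDegree = (intMinpoly β).natDegree := by
    rw [natDegree_intMinpoly halg, natDegree_eq_of_degree_eq (degree_eq_degree_of_associated hass),
      natDegree_map_eq_of_injective (RingHom.injective_int _)]
  have hirr : Irreducible ((intMinpoly β).map (Int.castRingHom ℚ)) :=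
    (hp.irreducible_iff_irreducible_map_fraction_map (K := ℚ)).1 (irreducible_intMinpoly halg)
  have hass' := (minpoly.irreducible halg.isIntegral).associated_of_dvd hirr <| by
    apply minpoly.dvd
    rw [← algebraMap_int_eq, aeval_map_algebraMap]
    exact aeval_intMinpoly halg
  have hdvd : intMinpoly β ∣ Q :=
    (IsPrimitive.Int.dvd_iff_map_cast_dvd_map_cast _ _ hp).2 (hass'.symm.trans hass).dvd
  obtain ⟨R, hR⟩ := hdvd
  have hR0 : R ≠ 0 := by rintro rfl; simp at hR; exact hQ0 hR
  have hRdeg : R.natDegree = 0 := by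
    have := congrArg natDegree hR
    rw [natDegree_mul hp.ne_zero hR0] at this
    omega
  refine ⟨R.coeff 0, fun h0 => hR0 ?_, ?_⟩
  · rw [eq_C_of_natDegree_eq_zero hRdeg, h0, C_0]
  · rw [← eq_C_of_natDegree_eq_zero hRdeg, mul_comm]; exact hR

theorem supNorm_C_mul (n : ℤ) (P : ℤ[X]) : (C n * P).supNorm = |(n : ℝ)| * P.supNorm := by
  apply le_antisymm
  · obtain ⟨i, hi⟩ := (C n * P).exists_eq_supNorm
    rw [hi, coeff_C_mul, norm_mul, Int.norm_eq_abs]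
    gcongr
    exact P.le_supNorm i
  · obtain ⟨i, hi⟩ := P.exists_eq_supNorm
    refine le_trans (le_of_eq ?_) ((C n * P).le_supNorm i)
    rw [hi, coeff_C_mul, norm_mul, Int.norm_eq_abs n]

end Heights

/-! ### The roots of `Q_k` -/

section Roots

open Filter Asymptotics Topology

variable {ξ : ℝ} {Y : ℕ → ℕ} {y : ℕ → Fin 3 → ℤ}

theorem coeff_Qpoly (y : ℕ → Fin 3 → ℤ) (k : ℕ) (i : Fin 3) :
    (Qpoly y k).coeff i = crossProduct (y k) (y (k + 1)) i := by
  rw [Qpoly_eq]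
  generalize crossProduct (y k) (y (k + 1)) = w
  simp only [coeff_add, coeff_C_mul, coeff_X_pow, coeff_X, coeff_C]
  fin_cases i <;> simp

theorem abs_cross_le_supNorm (y : ℕ → Fin 3 → ℤ) (k : ℕ) (i : Fin 3) :
    |(crossProduct (y k) (y (k + 1)) i : ℝ)| ≤ (Qpoly y k).supNorm := by
  have h := (Qpoly y k).le_supNorm i
  rwa [Int.norm_eq_abs, coeff_Qpoly] at h

theorem exists_supNorm_Qpoly_eq (y : ℕ → Fin 3 → ℤ) (k : ℕ) :
    ∃ i, (Qpoly y k).supNorm = |(crossProduct (y k) (y (k + 1)) i : ℝ)| := by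
  obtain ⟨i, hi⟩ := (Qpoly y k).exists_eq_supNorm
  rw [Int.norm_eq_abs] at hi
  rcases lt_or_ge i 3 with h3 | h3
  · exact ⟨⟨i, h3⟩, by rw [hi, ← coeff_Qpoly]⟩
  · refine ⟨0, le_antisymm ?_ (abs_cross_le_supNorm y k 0)⟩
    have h0 : (Qpoly y k).coeff i = 0 := by
      refine coeff_eq_zero_of_natDegree_lt (lt_of_le_of_lt ?_ (Nat.lt_of_succ_le h3))
      rw [Qpoly_eq]; exact natDegree_quadratic_le
    rw [hi, h0]; simp

theorem IsApproxSeq.isTheta_supNorm (h : IsApproxSeq ξ Y y) :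
    (fun k => (Qpoly y k).supNorm) =Θ[atTop] fun k => (Y (k + 1) : ℝ) * (Y k : ℝ)⁻¹ := by
  constructor
  · have h2 : (fun k => (crossProduct (y k) (y (k + 1)) 2 : ℝ)) =O[atTop]
        fun k => (Y (k + 1) : ℝ) * (Y k : ℝ)⁻¹ :=
      h.isBigO_qLead.congr_left fun k => (cross_two_eq ξ y k).symm
    have h1 : (fun k => (crossProduct (y k) (y (k + 1)) 1 : ℝ)) =O[atTop]
        fun k => (Y (k + 1) : ℝ) * (Y k : ℝ)⁻¹ :=
      (h.isTheta_qDeriv.1.sub (h.isBigO_qLead.const_mul_left (2 * ξ))).congr_left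
        fun k => (cross_one_eq ξ y k).symm
    have hv : qVal ξ y =O[atTop] fun k => (Y (k + 1) : ℝ) * (Y k : ℝ)⁻¹ := by
      refine h.isBigO_qVal.trans (IsBigO.mul (IsBigO.of_bound 1 ?_) (isBigO_refl _ _))
      filter_upwards [h.tendsto_succ.eventually_ge_atTop 1] with k hk
      rw [one_mul, Real.norm_of_nonneg (by positivity), Real.norm_of_nonneg (by positivity)]
      exact (inv_le_one_of_one_le₀ hk).trans hk
    have h0 : (fun k => (crossProduct (y k) (y (k + 1)) 0 : ℝ)) =O[atTop]
        fun k => (Y (k + 1) : ℝ) * (Y k : ℝ)⁻¹ :=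
      ((hv.sub (h.isTheta_qDeriv.1.const_mul_left ξ)).add
        (h.isBigO_qLead.const_mul_left (ξ ^ 2))).congr_left fun k => (cross_zero_eq ξ y k).symm
    refine IsBigO.trans (IsBigO.of_norm_le fun k => ?_)
      ((h0.abs_left.add h1.abs_left).add h2.abs_left)
    obtain ⟨i, hi⟩ := exists_supNorm_Qpoly_eq y k
    rw [Real.norm_of_nonneg (supNorm_nonneg _), hi]
    have a0 := abs_nonneg (crossProduct (y k) (y (k + 1)) 0 : ℝ)
    have a1 := abs_nonneg (crossProduct (y k) (y (k + 1)) 1 : ℝ)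
    have a2 := abs_nonneg (crossProduct (y k) (y (k + 1)) 2 : ℝ)
    fin_cases i <;> simp only [Fin.zero_eta, Fin.mk_one, Fin.reduceFinMk] <;> linarith
  · refine h.isTheta_qDeriv.2.trans (IsBigO.of_bound (1 + 2 * |ξ|)
      (Eventually.of_forall fun k => ?_))
    have e1 := cross_one_eq ξ y k
    rw [← cross_two_eq] at e1
    have e : qDeriv ξ y k = crossProduct (y k) (y (k + 1)) 1
        + 2 * ξ * crossProduct (y k) (y (k + 1)) 2 := by linarith
    rw [Real.norm_of_nonneg (supNorm_nonneg _), e, Real.norm_eq_abs]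
    refine (abs_add_le _ _).trans ?_
    rw [abs_mul, abs_mul, abs_two]
    have a1 := abs_cross_le_supNorm y k 1
    have a2 := abs_cross_le_supNorm y k 2
    have := mul_le_mul_of_nonneg_left a2 (show 0 ≤ 2 * |ξ| by positivity)
    linarith

/-- The content of `Q_k` divides `det (y_k, y_{k+1}, y_{k+2})`, hence is bounded, so the roots of
`Q_k` have a height comparable to the largest coefficient of `Q_k`. -/
theorem IsApproxSeq.exists_algHeight_bounds (h : IsApproxSeq ξ Y y) :
    ∃ K : ℝ, 0 < K ∧ ∀ k, 1 ≤ k → Irreducible ((Qpoly y k).map (Int.castRingHom ℚ)) →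
      ∀ β : ℂ, aeval β (Qpoly y k) = 0 →
        algHeight β ≤ (Qpoly y k).supNorm ∧ (Qpoly y k).supNorm ≤ K * algHeight β := by
  obtain ⟨K, hK, hdet⟩ := h.det3_bdd
  refine ⟨K, hK, fun k hk hirr β hβ => ?_⟩
  obtain ⟨n, hn, hQ⟩ := exists_eq_C_mul_intMinpoly hirr hβ
  have hsup : (Qpoly y k).supNorm = |(n : ℝ)| * algHeight β := by
    rw [hQ, supNorm_C_mul, algHeight]
  have hH : 0 ≤ algHeight β := supNorm_nonneg _
  have hn1 : (1 : ℝ) ≤ |(n : ℝ)| := by exact_mod_cast Int.one_le_abs hn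
  have hnK : |(n : ℝ)| ≤ K := by
    have hdvd : ∀ i, n ∣ crossProduct (y k) (y (k + 1)) i := by
      intro i
      rw [← coeff_Qpoly, hQ, coeff_C_mul]; exact dvd_mul_right _ _
    have hd : n ∣ det3 (y k) (y (k + 1)) (y (k + 2)) := by
      rw [det3_eq_dot_cross, triple_product_permutation, triple_product_permutation,
        Matrix.vec3_dotProduct]
      exact dvd_add (dvd_add ((hdvd 0).mul_left _) ((hdvd 1).mul_left _)) ((hdvd 2).mul_left _)
    have hne : det3 (y k) (y (k + 1)) (y (k + 2)) ≠ 0 := by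
      intro h0
      have := h.one_le_det3 k hk
      rw [h0] at this; norm_num at this
    have h1 := Int.le_of_dvd (abs_pos.2 hne) ((abs_dvd_abs _ _).2 hd)
    have h2 : |(det3 (y k) (y (k + 1)) (y (k + 2)) : ℝ)| ≤ K * 1 := hdet k hk
    rw [mul_one] at h2
    exact le_trans (by exact_mod_cast h1) h2
  rw [hsup]
  exact ⟨by nlinarith, by gcongr⟩

/-- In terms of sizes, the roots of `Q_k` satisfy `H ^ (γ ^ 2) ∼ Y_{k+1}`. -/
theorem IsApproxSeq.exists_algHeight_rpow_bounds (h : IsApproxSeq ξ Y y) :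
    ∃ K : ℝ, 0 < K ∧ ∀ᶠ k in atTop, ∀ β : ℂ, aeval β (Qpoly y k) = 0 →
      algHeight β ^ (-2 * Real.goldenRatio ^ 2) ≤ K * ((Y (k + 1) : ℝ) ^ 2)⁻¹ ∧
      ((Y (k + 1) : ℝ) ^ 2)⁻¹ ≤ K * algHeight β ^ (-2 * Real.goldenRatio ^ 2) := by
  obtain ⟨K, hK, hbd⟩ := h.exists_algHeight_bounds
  have hS : ∀ k, 0 ≤ (Qpoly y k).supNorm := fun k => supNorm_nonneg _
  have h1 : (fun k => (Qpoly y k).supNorm ^ (2 * Real.goldenRatio ^ 2)) =Θ[atTop]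
      fun k => (Y (k + 1) : ℝ) ^ 2 := by
    have e1 : (fun k => (Qpoly y k).supNorm ^ Real.goldenRatio) =Θ[atTop] fun k => (Y k : ℝ) :=
      IsTheta.trans (h.isTheta_supNorm.rpow (Eventually.of_forall hS)
        (Eventually.of_forall fun k => by simp only [Pi.zero_apply]; positivity))
        h.isTheta_ratio_rpow
    refine EventuallyEq.trans_isTheta (Eventually.of_forall fun k => ?_)
      (((e1.mul h.isTheta_supNorm).pow 2).trans_eventuallyEq ?_)
    · change (Qpoly y k).supNorm ^ (2 * Real.goldenRatio ^ 2) =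
        ((Qpoly y k).supNorm ^ Real.goldenRatio * (Qpoly y k).supNorm) ^ 2
      have hg := Real.goldenRatio_pos
      have e : 2 * Real.goldenRatio ^ 2 = (Real.goldenRatio + 1) * (2 : ℕ) := by
        rw [Real.goldenRatio_sq]; push_cast; ring
      rw [← Real.rpow_add_one' (hS k) (by positivity), e, Real.rpow_mul_natCast (hS k)]
    · filter_upwards [h.eventually_pos] with k hk
      field_simp
  have h2 := h1.inv
  obtain ⟨K₁, hK₁, b1⟩ := h2.1.exists_pos
  obtain ⟨K₂, hK₂, b2⟩ := h2.2.exists_pos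
  have hγ : 0 ≤ 2 * Real.goldenRatio ^ 2 := by positivity
  refine ⟨K₂ + K ^ (2 * Real.goldenRatio ^ 2) * K₁, by positivity, ?_⟩
  filter_upwards [b1.bound, b2.bound, h.eventually_irreducible, eventually_ge_atTop 1,
    h.tendsto_succ.eventually_gt_atTop 0] with k c1 c2 c3 c4 c5 β hβ
  obtain ⟨d1, d2⟩ := hbd k c4 c3.1 β hβ
  have hβalg : IsAlgebraic ℚ β := ⟨_, c3.1.ne_zero, by
    rw [← algebraMap_int_eq, aeval_map_algebraMap]; exact hβ⟩
  have hH : 0 < algHeight β := zero_lt_one.trans_le (one_le_algHeight hβalg)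
  have hSk : 0 < (Qpoly y k).supNorm := hH.trans_le d1
  generalize (Qpoly y k).supNorm = S at c1 c2 d1 d2 hSk
  generalize algHeight β = H at d1 d2 hH ⊢
  have hpos : 0 < ((Y (k + 1) : ℝ) ^ 2)⁻¹ := by positivity
  have hSp : 0 ≤ (S ^ (2 * Real.goldenRatio ^ 2))⁻¹ := by positivity
  rw [Real.norm_of_nonneg hSp, Real.norm_of_nonneg hpos.le] at c1
  rw [Real.norm_of_nonneg hpos.le, Real.norm_of_nonneg hSp] at c2
  have e : -2 * Real.goldenRatio ^ 2 = -(2 * Real.goldenRatio ^ 2) := by ring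
  rw [e, Real.rpow_neg hH.le]
  have hHinv : 0 < (H ^ (2 * Real.goldenRatio ^ 2))⁻¹ := by positivity
  constructor
  · have f1 : (H ^ (2 * Real.goldenRatio ^ 2))⁻¹ ≤ K ^ (2 * Real.goldenRatio ^ 2) *
        (S ^ (2 * Real.goldenRatio ^ 2))⁻¹ := by
      have f0 : S ^ (2 * Real.goldenRatio ^ 2) ≤
          K ^ (2 * Real.goldenRatio ^ 2) * H ^ (2 * Real.goldenRatio ^ 2) := by
        rw [← Real.mul_rpow hK.le hH.le]
        exact Real.rpow_le_rpow hSk.le d2 hγ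
      rw [← div_eq_mul_inv, le_div_iff₀ (by positivity), inv_mul_le_iff₀ (by positivity)]
      exact f0.trans_eq (mul_comm _ _)
    calc _ ≤ _ := f1
      _ ≤ K ^ (2 * Real.goldenRatio ^ 2) * (K₁ * ((Y (k + 1) : ℝ) ^ 2)⁻¹) := by gcongr
      _ ≤ _ := by rw [← mul_assoc]; gcongr; linarith
  · have f1 : (S ^ (2 * Real.goldenRatio ^ 2))⁻¹ ≤
        (H ^ (2 * Real.goldenRatio ^ 2))⁻¹ := by gcongr
    calc _ ≤ _ := c2
      _ ≤ K₂ * (H ^ (2 * Real.goldenRatio ^ 2))⁻¹ := by gcongr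
      _ ≤ _ := by gcongr; simp only [le_add_iff_nonneg_right]; positivity

/-- A real quadratic `a + b t + c t²` with small `a` and large `b` has one complex root near `0`, of
size `|a / b|`, while the other one stays away from `0`. -/
theorem exists_small_root {a b c M : ℝ} (hc : c ≠ 0) (hb : b ≠ 0) (hcM : |c| ≤ M * |b|)
    (ha : |a| ≤ |b| / 2) :
    ∃ t : ℂ, (a + b * t + c * t ^ 2 = 0) ∧ ‖t‖ ≤ 2 * |a| / |b| ∧ |a| ≤ (1 + M) * |b| * ‖t‖ ∧
      ∀ s : ℂ, a + b * s + c * s ^ 2 = 0 → s ≠ t → 1 / (2 * M) ≤ ‖s‖ := by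
  have hb0 : 0 < |b| := abs_pos.2 hb
  have hc0 : 0 < |c| := abs_pos.2 hc
  have hM : 0 < M := by
    by_contra hM
    nlinarith [not_lt.1 hM]
  have hcC : (c : ℂ) ≠ 0 := by exact_mod_cast hc
  obtain ⟨t₁, t₂, hle, hfac⟩ : ∃ t₁ t₂ : ℂ, ‖t₁‖ ≤ ‖t₂‖ ∧
      ∀ s : ℂ, a + b * s + c * s ^ 2 = c * (s - t₁) * (s - t₂) := by
    obtain ⟨r, hr⟩ := IsAlgClosed.exists_root (C (c : ℂ) * X ^ 2 + C (b : ℂ) * X + C (a : ℂ))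
      (by rw [degree_quadratic hcC]; norm_num)
    have hr' : (c : ℂ) * r ^ 2 + b * r + a = 0 := by simpa [IsRoot] using hr
    have key : ∀ s : ℂ, a + b * s + c * s ^ 2 = c * (s - r) * (s - (-b / c - r)) := by
      intro s
      have h2 : (c : ℂ) * (s - (-b / c - r)) = c * s + b + c * r := by field_simp; ring
      rw [mul_right_comm, h2]; linear_combination hr'
    rcases le_total ‖r‖ ‖(-b / c - r : ℂ)‖ with h | h
    · exact ⟨r, _, h, key⟩
    · exact ⟨_, r, h, fun s => by rw [key s]; ring⟩
  have hsum : (b : ℂ) = -c * (t₁ + t₂) := by linear_combination (hfac 1 - hfac (-1)) / 2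
  have hprod : (a : ℂ) = c * t₁ * t₂ := by linear_combination hfac 0
  have hb2 : |b| ≤ 2 * (|c| * ‖t₂‖) := by
    have h1 : |b| = |c| * ‖t₁ + t₂‖ := by
      have := congrArg norm hsum
      simpa using this
    rw [h1]
    nlinarith [norm_add_le t₁ t₂]
  have ha' : |a| = ‖t₁‖ * (|c| * ‖t₂‖) := by
    have := congrArg norm hprod
    simp only [Complex.norm_real, norm_mul, Real.norm_eq_abs] at this
    rw [this]; ring
  have hup : ‖t₁‖ ≤ 2 * |a| / |b| := by
    rw [le_div_iff₀ hb0, ha']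
    nlinarith [norm_nonneg t₁]
  refine ⟨t₁, by rw [hfac]; ring, hup, ?_, fun s hs hne => ?_⟩
  · have ht1 : ‖t₁‖ ≤ 1 := hup.trans (by rw [div_le_one hb0]; linarith)
    have h1 : |c| * ‖t₂‖ ≤ (1 + M) * |b| := by
      have h2 : (c : ℂ) * t₂ = -(b + c * t₁) := by rw [hsum]; ring
      have h3 := congrArg norm h2
      rw [norm_mul, norm_neg, Complex.norm_real, Real.norm_eq_abs] at h3
      rw [h3]
      refine (norm_add_le _ _).trans ?_
      rw [norm_mul, Complex.norm_real, Complex.norm_real, Real.norm_eq_abs, Real.norm_eq_abs]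
      nlinarith [norm_nonneg t₁]
    rw [ha', mul_comm]
    gcongr
  · rw [hfac] at hs
    have hs2 : s = t₂ := by
      rcases mul_eq_zero.1 hs with h | h
      · rcases mul_eq_zero.1 h with h | h
        · exact absurd h hcC
        · exact absurd (sub_eq_zero.1 h) hne
      · exact sub_eq_zero.1 h
    rw [hs2, div_le_iff₀ (by positivity)]
    have h1 : |b| * 1 ≤ |b| * (‖t₂‖ * (2 * M)) := by nlinarith [norm_nonneg t₂]
    exact le_of_mul_le_mul_left h1 hb0

/-- For large `k`, one root of `Q_k` is at distance about `Y_{k+1} ^ (-2)` from `ξ`, the other one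
at a distance bounded below. -/
theorem IsApproxSeq.exists_close_root (h : IsApproxSeq ξ Y y) :
    ∃ K c₀ : ℝ, 0 < K ∧ 0 < c₀ ∧ ∀ᶠ k in atTop, ∃ α : ℂ, aeval α (Qpoly y k) = 0 ∧
      ‖(ξ : ℂ) - α‖ ≤ K * ((Y (k + 1) : ℝ) ^ 2)⁻¹ ∧ ((Y (k + 1) : ℝ) ^ 2)⁻¹ ≤ K * ‖(ξ : ℂ) - α‖ ∧
      ∀ β : ℂ, aeval β (Qpoly y k) = 0 → β ≠ α → c₀ ≤ ‖(ξ : ℂ) - β‖ := by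
  obtain ⟨A₁, hA₁, a1⟩ := h.isTheta_qVal.1.exists_pos
  obtain ⟨A₂, hA₂, a2⟩ := h.isTheta_qVal.2.exists_pos
  obtain ⟨B₁, hB₁, b1⟩ := h.isTheta_qDeriv.1.exists_pos
  obtain ⟨B₂, hB₂, b2⟩ := h.isTheta_qDeriv.2.exists_pos
  obtain ⟨M, hM, m⟩ := (h.isBigO_qLead.trans h.isTheta_qDeriv.2).exists_pos
  have hsmall : ∀ᶠ k in atTop, A₁ * B₂ * (Y (k + 1) : ℝ)⁻¹ ≤ 1 / 2 := by
    have h1 : Tendsto (fun k => A₁ * B₂ * (Y (k + 1) : ℝ)⁻¹) atTop (𝓝 (A₁ * B₂ * 0)) :=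
      h.tendsto_succ.inv_tendsto_atTop.const_mul _
    rw [mul_zero] at h1
    exact h1.eventually_le_const (by norm_num)
  refine ⟨2 * A₁ * B₂ + A₂ * (1 + M) * B₁, 1 / (2 * M), by positivity, by positivity, ?_⟩
  filter_upwards [a1.bound, a2.bound, b1.bound, b2.bound, m.bound, h.eventually_pos, hsmall,
    h.tendsto_succ.eventually_ge_atTop 1, h.eventually_irreducible]
    with k a1 a2 b1 b2 m hk hs hk1 hirr
  set Z := (Y (k + 1) : ℝ) with hZ
  set W := (Y k : ℝ) with hW
  have hZ0 : 0 < Z := by linarith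
  have hr1 : 0 ≤ Z⁻¹ * W⁻¹ := by positivity
  have hr2 : 0 ≤ Z * W⁻¹ := by positivity
  rw [Real.norm_of_nonneg hr1, Real.norm_eq_abs] at a1 a2
  rw [Real.norm_of_nonneg hr2, Real.norm_eq_abs] at b1 b2
  rw [Real.norm_eq_abs, Real.norm_eq_abs] at m
  have hb : 0 < |qDeriv ξ y k| := by
    have : 0 < Z * W⁻¹ := by positivity
    nlinarith
  have hc : qLead ξ y k ≠ 0 := by
    intro h0
    have hcoef : crossProduct (y k) (y (k + 1)) 2 = 0 := by
      have := cross_two_eq ξ y k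
      rw [h0] at this; exact_mod_cast this
    have h2 := hirr.2
    rw [Qpoly_eq, hcoef, C_0, zero_mul, zero_add] at h2
    have := natDegree_linear_le (a := crossProduct (y k) (y (k + 1)) 1)
      (b := crossProduct (y k) (y (k + 1)) 0)
    omega
  have hZW : Z⁻¹ * W⁻¹ ≤ B₂ * (Z ^ 2)⁻¹ * |qDeriv ξ y k| := by
    calc Z⁻¹ * W⁻¹ = (Z ^ 2)⁻¹ * (Z * W⁻¹) := by field_simp
      _ ≤ (Z ^ 2)⁻¹ * (B₂ * |qDeriv ξ y k|) := by gcongr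
      _ = _ := by ring
  have hab : |qVal ξ y k| ≤ A₁ * B₂ * (Z ^ 2)⁻¹ * |qDeriv ξ y k| := by
    calc _ ≤ A₁ * (Z⁻¹ * W⁻¹) := a1
      _ ≤ A₁ * (B₂ * (Z ^ 2)⁻¹ * |qDeriv ξ y k|) := by gcongr
      _ = _ := by ring
  have hZ2 : (Z ^ 2)⁻¹ ≤ Z⁻¹ := by gcongr; nlinarith
  obtain ⟨t, t0, t1, t2, t3⟩ := exists_small_root hc (abs_pos.1 hb) m (a := qVal ξ y k) (by
    refine hab.trans ?_
    have : A₁ * B₂ * (Z ^ 2)⁻¹ ≤ 1 / 2 := le_trans (by gcongr) hs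
    nlinarith)
  have hnorm : ‖(ξ : ℂ) - (ξ + t)‖ = ‖t‖ := by rw [sub_add_cancel_left, norm_neg]
  refine ⟨ξ + t, ?_, ?_, ?_, fun β hβ hne => ?_⟩
  · rw [aeval_Qpoly ξ, add_sub_cancel_left]; exact t0
  · rw [hnorm]
    refine t1.trans ?_
    rw [div_le_iff₀ hb]
    have : 0 ≤ A₂ * (1 + M) * B₁ * (Z ^ 2)⁻¹ * |qDeriv ξ y k| := by positivity
    nlinarith
  · rw [hnorm]
    have h1 : Z⁻¹ * W⁻¹ ≤ A₂ * ((1 + M) * (B₁ * (Z * W⁻¹)) * ‖t‖) := by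
      refine a2.trans ?_
      gcongr
      refine t2.trans ?_
      gcongr
    have h2 : (Z ^ 2)⁻¹ ≤ A₂ * (1 + M) * B₁ * ‖t‖ := by
      have h3 : (Z ^ 2)⁻¹ * (Z * W⁻¹) = Z⁻¹ * W⁻¹ := by field_simp
      have h4 : 0 < Z * W⁻¹ := by positivity
      refine le_of_mul_le_mul_right ?_ h4
      rw [h3]; linarith
    have : 0 ≤ 2 * A₁ * B₂ * ‖t‖ := by positivity
    linarith
  · have hβt := t3 (β - ξ) (by rw [← aeval_Qpoly]; exact hβ) (fun h0 => hne (by rw [← h0]; ring))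
    rwa [norm_sub_rev]

end Roots

/-! ### Approximation by quadratic numbers -/

section QuadraticApproximation

open Filter Asymptotics Topology

variable {ξ : ℝ} {Y : ℕ → ℕ} {y : ℕ → Fin 3 → ℤ}

open Matrix in
/-- A vector orthogonal to `a` and `b` is proportional to `a × b`. -/
theorem mul_cross_eq_mul_of_dotProduct_eq_zero {R : Type*} [CommRing R] {u a b : Fin 3 → R}
    (ha : u ⬝ᵥ a = 0) (hb : u ⬝ᵥ b = 0) (i j : Fin 3) :
    u i * crossProduct a b j = u j * crossProduct a b i := by
  rw [vec3_dotProduct] at ha hb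
  rw [cross_apply]
  fin_cases i <;> fin_cases j <;> simp <;>
    first
    | ring1
    | linear_combination a 0 * hb - b 0 * ha
    | linear_combination b 0 * ha - a 0 * hb
    | linear_combination a 1 * hb - b 1 * ha
    | linear_combination b 1 * ha - a 1 * hb
    | linear_combination a 2 * hb - b 2 * ha
    | linear_combination b 2 * ha - a 2 * hb

theorem aeval_Qpoly_eq_cross (y : ℕ → Fin 3 → ℤ) (k : ℕ) (β : ℂ) :
    aeval β (Qpoly y k) = crossProduct (y k) (y (k + 1)) 0
      + crossProduct (y k) (y (k + 1)) 1 * β + crossProduct (y k) (y (k + 1)) 2 * β ^ 2 := by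
  rw [Qpoly_eq]
  simp only [map_add, map_mul, map_pow, aeval_X, aeval_C, algebraMap_int_eq, Int.coe_castRingHom]
  ring

/-- If the coefficient vector `u` of an integral polynomial `P` of degree at most `2` is orthogonal
to both `y_k` and `y_{k+1}`, then `P` is proportional to `Q_k`. Otherwise one of the two products
is a non-zero integer, which bounds `P(ξ)` from below in terms of `Y_{k+1}`. -/
theorem IsApproxSeq.exists_le_quadratic_form (h : IsApproxSeq ξ Y y) :
    ∃ K : ℝ, 0 < K ∧ ∀ᶠ k in atTop, ∀ (u : Fin 3 → ℤ) (H : ℝ), u ≠ 0 → (∀ i, |(u i : ℝ)| ≤ H) →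
      K * H ≤ Y k →
      1 ≤ K * Y (k + 1) * |u 0 + u 1 * ξ + u 2 * ξ ^ 2| ∨
        ∀ β : ℂ, (u 0 : ℂ) + u 1 * β + u 2 * β ^ 2 = 0 → aeval β (Qpoly y k) = 0 := by
  obtain ⟨K, hK, hev⟩ := h.exists_bounds
  obtain ⟨k₀, hk₀⟩ := eventually_atTop.1 (hev.and h.eventually_pos)
  refine ⟨4 * K, by positivity, ?_⟩
  filter_upwards [eventually_ge_atTop k₀, eventually_ge_atTop 1] with k hk hk1 u H hu hH hHY
  have hH0 : 0 ≤ H := (abs_nonneg _).trans (hH 0)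
  have hmono : (Y k : ℝ) ≤ Y (k + 1) := by exact_mod_cast (h.strictMono k hk1).le
  have key : ∀ j, k₀ ≤ j → (Y k : ℝ) ≤ Y j → (Y j : ℝ) ≤ Y (k + 1) →
      u ⬝ᵥ y j ≠ 0 → 1 ≤ 4 * K * Y (k + 1) * |u 0 + u 1 * ξ + u 2 * ξ ^ 2| := by
    intro j hj hkj hjk hne
    obtain ⟨⟨b0, -, b1, -, b2⟩, hpos⟩ := hk₀ j hj
    have h1 : (1 : ℝ) ≤ |((u ⬝ᵥ y j : ℤ) : ℝ)| := by exact_mod_cast Int.one_le_abs hne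
    have h2 : ((u ⬝ᵥ y j : ℤ) : ℝ) = y j 0 * (u 0 + u 1 * ξ + u 2 * ξ ^ 2)
        + u 1 * (y j 1 - ξ * y j 0) + u 2 * (y j 2 - ξ ^ 2 * y j 0) := by
      rw [Matrix.vec3_dotProduct]; push_cast; ring
    have h3 : (1 : ℝ) ≤ K * Y j * |u 0 + u 1 * ξ + u 2 * ξ ^ 2| + H * (K * (Y j : ℝ)⁻¹)
        + H * (K * (Y j : ℝ)⁻¹) := by
      rw [h2] at h1
      refine h1.trans ((abs_add_le _ _).trans (add_le_add ((abs_add_le _ _).trans ?_) ?_))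
      · rw [abs_mul, abs_mul]
        gcongr
        exact hH 1
      · rw [abs_mul]
        gcongr
        exact hH 2
    have h4 : H * (K * (Y j : ℝ)⁻¹) ≤ 1 / 4 := by
      rw [← mul_assoc, ← div_eq_mul_inv, div_le_iff₀ hpos]; linarith
    have h5 : K * Y j * |u 0 + u 1 * ξ + u 2 * ξ ^ 2| ≤
        K * Y (k + 1) * |u 0 + u 1 * ξ + u 2 * ξ ^ 2| := by gcongr
    linarith
  by_cases hu0 : u ⬝ᵥ y k = 0
  · by_cases hu1 : u ⬝ᵥ y (k + 1) = 0
    · right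
      intro β hβ
      obtain ⟨i, hi⟩ := Function.ne_iff.1 hu
      have hpar : ∀ j, (u i : ℂ) * crossProduct (y k) (y (k + 1)) j
          = u j * crossProduct (y k) (y (k + 1)) i := fun j => by
        exact_mod_cast mul_cross_eq_mul_of_dotProduct_eq_zero hu0 hu1 i j
      have hi' : (u i : ℂ) ≠ 0 := by exact_mod_cast hi
      refine (mul_eq_zero.1 ?_).resolve_left hi'
      rw [aeval_Qpoly_eq_cross]
      linear_combination hpar 0 + β * hpar 1 + β ^ 2 * hpar 2 +
        crossProduct (y k) (y (k + 1)) i * hβ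
    · exact Or.inl (key (k + 1) (by omega) hmono le_rfl hu1)
  · exact Or.inl (key k hk le_rfl hmono hu0)

/-- An algebraic number `β` of degree at most `2` which is not a root of any `Q_k` satisfies
`|ξ - β| ≫ H(β) ^ (-γ² - 1) ≫ H(β) ^ (-4)`; for the roots of `Q_k` that are not close to `ξ` the
bound is trivial. -/
theorem IsApproxSeq.exists_le_dist (h : IsApproxSeq ξ Y y) {c₀ : ℝ} (hc₀ : 0 < c₀) (k₀ : ℕ) :
    ∃ c : ℝ, 0 < c ∧ ∀ β : ℂ, IsAlgebraic ℚ β → (minpoly ℚ β).natDegree ≤ 2 →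
      (∀ k, k₀ ≤ k → aeval β (Qpoly y k) = 0 → c₀ ≤ ‖(ξ : ℂ) - β‖) →
      c * algHeight β ^ (-4 : ℤ) ≤ ‖(ξ : ℂ) - β‖ := by
  obtain ⟨K, hK, hev⟩ := h.exists_le_quadratic_form
  obtain ⟨k₁, hk₁⟩ := eventually_atTop.1 hev
  obtain ⟨D, hD, hsc⟩ := h.exists_scale hK (max (max k₀ k₁) 1)
  obtain ⟨G, hG, hgrow⟩ := h.growth.1
  have hγ := Real.goldenRatio_pos
  set c₂ := 1 / (K * (G * D ^ Real.goldenRatio) * (2 + 2 * |ξ|)) with hc₂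
  have hc₂0 : 0 < c₂ := by positivity
  refine ⟨min 1 (min c₀ c₂), by positivity, fun β hβ hdeg hroot => ?_⟩
  have hH1 := one_le_algHeight hβ
  have hsup : ∀ i, |((intMinpoly β).coeff i : ℝ)| ≤ algHeight β := fun i => by
    rw [← Int.norm_eq_abs]; exact le_supNorm _ i
  have hne := (irreducible_intMinpoly hβ).ne_zero
  have hP := aeval_intMinpoly hβ
  have hdeg' : (intMinpoly β).natDegree ≤ 2 := by rwa [natDegree_intMinpoly hβ]
  rw [eq_quadratic_of_degree_le_two (natDegree_le_iff_degree_le.1 hdeg')] at hP hne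
  generalize algHeight β = H at hH1 hsup ⊢
  set u : Fin 3 → ℤ := fun i => (intMinpoly β).coeff i with hu
  have hβu : (u 0 : ℂ) + u 1 * β + u 2 * β ^ 2 = 0 := by
    simp only [map_add, map_mul, map_pow, aeval_X, aeval_C, algebraMap_int_eq,
      Int.coe_castRingHom] at hP
    rw [← hP, hu]; simp only [Fin.val_zero, Fin.val_one, Fin.val_two]; ring
  have hu0 : u ≠ 0 := by
    intro h0
    have h1 : ∀ i : Fin 3, (intMinpoly β).coeff i = 0 := fun i => congrFun h0 i
    apply hne
    have a0 := h1 0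
    have a1 := h1 1
    have a2 := h1 2
    simp only [Fin.val_zero, Fin.val_one, Fin.val_two] at a0 a1 a2
    rw [a0, a1, a2]; simp
  obtain ⟨k, hk, hlow, hup⟩ := hsc H hH1
  simp only [max_le_iff] at hk
  have hH4 : H ^ (-4 : ℤ) ≤ 1 := by
    rw [zpow_neg]; exact inv_le_one_of_one_le₀ (by exact_mod_cast one_le_pow₀ hH1)
  have hH4' : 0 < H ^ (-4 : ℤ) := by positivity
  rcases hk₁ k hk.1.2 u H hu0 (fun i => hsup i) hlow with hval | hQ
  · rcases le_total 1 ‖(ξ : ℂ) - β‖ with hfar | hnear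
    · refine le_trans ?_ hfar
      calc _ ≤ 1 * H ^ (-4 : ℤ) := by gcongr; exact min_le_left _ _
        _ ≤ 1 := by rw [one_mul]; exact hH4
    · have hY : (Y (k + 1) : ℝ) ≤ G * D ^ Real.goldenRatio * H ^ 3 := by
        calc (Y (k + 1) : ℝ) ≤ G * (Y k : ℝ) ^ Real.goldenRatio := hgrow k hk.2
          _ ≤ G * (D * H ^ Real.goldenRatio) ^ Real.goldenRatio := by gcongr
          _ = G * D ^ Real.goldenRatio * H ^ (Real.goldenRatio ^ 2) := by
            rw [Real.mul_rpow hD.le (by positivity), ← Real.rpow_mul (by linarith), sq]; ring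
          _ ≤ G * D ^ Real.goldenRatio * H ^ (3 : ℝ) := by
            refine mul_le_mul_of_nonneg_left (Real.rpow_le_rpow_of_exponent_le hH1 ?_)
              (by positivity)
            rw [Real.goldenRatio_sq]; linarith [Real.goldenRatio_lt_two]
          _ = _ := by norm_cast
      have hdiff : |u 0 + u 1 * ξ + u 2 * ξ ^ 2| ≤ H * (2 + 2 * |ξ|) * ‖(ξ : ℂ) - β‖ := by
        have e1 : ((u 0 + u 1 * ξ + u 2 * ξ ^ 2 : ℝ) : ℂ)
            = (u 1 + u 2 * (2 * ξ - (ξ - β))) * (ξ - β) := by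
          push_cast; linear_combination hβu
        rw [← Real.norm_eq_abs, ← Complex.norm_real, e1, norm_mul]
        gcongr
        have n2 : ‖(2 * ξ - (ξ - β) : ℂ)‖ ≤ 2 * |ξ| + 1 := by
          refine (norm_sub_le _ _).trans ?_
          rw [norm_mul, Complex.norm_real, Real.norm_eq_abs, Complex.norm_ofNat]
          gcongr
        calc _ ≤ ‖(u 1 : ℂ)‖ + ‖(u 2 : ℂ)‖ * ‖(2 * ξ - (ξ - β) : ℂ)‖ := by
              rw [← norm_mul]; exact norm_add_le _ _
          _ ≤ H + H * (2 * |ξ| + 1) := by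
              rw [Complex.norm_intCast, Complex.norm_intCast]
              gcongr
              · exact hsup 1
              · exact hsup 2
          _ = _ := by ring
      have hfin : 1 ≤ K * (G * D ^ Real.goldenRatio) * (2 + 2 * |ξ|) * H ^ 4
          * ‖(ξ : ℂ) - β‖ := by
        calc (1 : ℝ) ≤ _ := hval
          _ ≤ K * (G * D ^ Real.goldenRatio * H ^ 3) *
              (H * (2 + 2 * |ξ|) * ‖(ξ : ℂ) - β‖) := by gcongr
          _ = _ := by ring
      calc _ ≤ c₂ * H ^ (-4 : ℤ) := by
            gcongr; exact (min_le_right _ _).trans (min_le_right _ _)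
        _ ≤ _ := by
          rw [hc₂, zpow_neg, ← div_eq_mul_inv, div_div, div_le_iff₀ (by positivity)]
          rw [show H ^ (4 : ℤ) = H ^ 4 by norm_cast]
          linarith
  · refine le_trans ?_ (hroot k hk.1.1 (hQ β hβu))
    calc _ ≤ c₀ * H ^ (-4 : ℤ) := by
          gcongr; exact (min_le_right _ _).trans (min_le_left _ _)
      _ ≤ c₀ := by nlinarith

/-- The approximation properties of the roots of the `Q_k`, for a given sequence of points. -/
theorem IsApproxSeq.quadratic_approximation (h : IsApproxSeq ξ Y y) :
    ∃ (k₀ : ℕ) (c₁ c₂ : ℝ) (α : ℕ → ℂ), 1 ≤ k₀ ∧ 0 < c₁ ∧ 0 < c₂ ∧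
        (∀ k, k₀ ≤ k →
          Irreducible ((Qpoly y k).map (Int.castRingHom ℚ)) ∧
          (Qpoly y k).natDegree = 2 ∧
          (Polynomial.aeval (α k) (Qpoly y k) = 0 ∧
            c₁ * algHeight (α k) ^ (-2 * Real.goldenRatio ^ 2) ≤ ‖(ξ : ℂ) - α k‖ ∧
            ‖(ξ : ℂ) - α k‖ ≤ c₂ * algHeight (α k) ^ (-2 * Real.goldenRatio ^ 2)) ∧
          (∀ β : ℂ, Polynomial.aeval β (Qpoly y k) = 0 →
            c₁ * algHeight β ^ (-2 * Real.goldenRatio ^ 2) ≤ ‖(ξ : ℂ) - β‖ →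
            ‖(ξ : ℂ) - β‖ ≤ c₂ * algHeight β ^ (-2 * Real.goldenRatio ^ 2) →
            β = α k)) ∧
        ∃ c₃ : ℝ, 0 < c₃ ∧ ∀ β : ℂ, IsAlgebraic ℚ β → (minpoly ℚ β).natDegree ≤ 2 →
          (∀ k, k₀ ≤ k → β ≠ α k) →
          c₃ * algHeight β ^ (-4 : ℤ) ≤ ‖(ξ : ℂ) - β‖ := by
  obtain ⟨K, c₀, hK, hc₀, hroot⟩ := h.exists_close_root
  obtain ⟨M, hM, hheight⟩ := h.exists_algHeight_rpow_bounds
  have hsmall : ∀ᶠ k in atTop, K * M * M * ((Y (k + 1) : ℝ) ^ 2)⁻¹ < c₀ := by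
    have h1 : Tendsto (fun k => K * M * M * ((Y (k + 1) : ℝ) ^ 2)⁻¹) atTop (𝓝 (K * M * M * 0)) :=
      (((tendsto_pow_atTop two_ne_zero).comp h.tendsto_succ).inv_tendsto_atTop).const_mul _
    rw [mul_zero] at h1
    exact h1.eventually_lt_const hc₀
  obtain ⟨k₀, hk₀⟩ := eventually_atTop.1 ((hroot.and hheight).and
    (hsmall.and (h.eventually_irreducible.and (eventually_ge_atTop 1))))
  choose α hα using fun k : {k // k₀ ≤ k} => (hk₀ k k.2).1.1
  let α' : ℕ → ℂ := fun k => if hk : k₀ ≤ k then α ⟨k, hk⟩ else 0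
  have hα' : ∀ k (hk : k₀ ≤ k), α' k = α ⟨k, hk⟩ := fun k hk => dif_pos hk
  refine ⟨k₀, 1 / (K * M), K * M, α', (hk₀ k₀ le_rfl).2.2.2, by positivity, by positivity,
    fun k hk => ?_, ?_⟩
  · obtain ⟨r1, r2, r3, r4⟩ := hα ⟨k, hk⟩
    obtain ⟨⟨-, hh⟩, hs, hirr, -⟩ := hk₀ k hk
    rw [hα' k hk]
    refine ⟨hirr.1, hirr.2, ⟨r1, ?_, ?_⟩, fun β hβ hβ1 hβ2 => ?_⟩
    · have h1 := (hh _ r1).1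
      rw [div_mul_eq_mul_div, one_mul, div_le_iff₀ (by positivity)]
      nlinarith
    · have h1 := (hh _ r1).2
      nlinarith
    · by_contra hne
      have h1 := r4 β hβ hne
      have h2 := (hh β hβ).1
      have h3 : K * M * algHeight β ^ (-2 * Real.goldenRatio ^ 2) ≤
          K * M * (M * ((Y (k + 1) : ℝ) ^ 2)⁻¹) := by gcongr
      linarith
  · obtain ⟨c, hc, hdist⟩ := h.exists_le_dist hc₀ k₀
    refine ⟨c, hc, fun β hβ hdeg hne => hdist β hβ hdeg fun k hk hβk => ?_⟩
    have hne' := hne k hk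
    rw [hα' k hk] at hne'
    exact (hα ⟨k, hk⟩).2.2.2 β hβk hne'

theorem algHeight_rpow_le_zpow {β : ℂ} (hβ : IsAlgebraic ℚ β) :
    algHeight β ^ (-2 * Real.goldenRatio ^ 2) ≤ algHeight β ^ (-4 : ℤ) := by
  rw [← Real.rpow_intCast]
  refine Real.rpow_le_rpow_of_exponent_le (one_le_algHeight hβ) ?_
  rw [Real.goldenRatio_sq]; push_cast; linarith [Real.one_lt_goldenRatio]

/-- The exponent `2γ²` is optimal for approximation by quadratic numbers as soon as one sequence of
points is available. -/
theorem IsApproxSeq.optimal_exponent (h : IsApproxSeq ξ Y y) :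
    (∃ c : ℝ, 0 < c ∧
      {β : ℂ | IsAlgebraic ℚ β ∧ (minpoly ℚ β).natDegree = 2 ∧
        ‖(ξ : ℂ) - β‖ ≤ c * algHeight β ^ (-2 * Real.goldenRatio ^ 2)}.Infinite) ∧
    (∃ c : ℝ, 0 < c ∧
      ∀ β : ℂ, IsAlgebraic ℚ β → (minpoly ℚ β).natDegree ≤ 2 →
        ¬ ‖(ξ : ℂ) - β‖ ≤ c * algHeight β ^ (-2 * Real.goldenRatio ^ 2)) := by
  obtain ⟨k₀, c₁, c₂, α, hk₀, hc₁, hc₂, hα, c₃, hc₃, hβ⟩ := h.quadratic_approximation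
  have halg : ∀ k, k₀ ≤ k → IsAlgebraic ℚ (α k) ∧ (minpoly ℚ (α k)).natDegree = 2 := by
    intro k hk
    obtain ⟨hirr, hdeg, ⟨hroot, -⟩, -⟩ := hα k hk
    have hroot' : aeval (α k) ((Qpoly y k).map (Int.castRingHom ℚ)) = 0 := by
      rw [← algebraMap_int_eq, aeval_map_algebraMap]; exact hroot
    have ha : IsAlgebraic ℚ (α k) := ⟨_, hirr.ne_zero, hroot'⟩
    have hass := (minpoly.irreducible ha.isIntegral).associated_of_dvd hirr
      (minpoly.dvd _ _ hroot')
    refine ⟨ha, ?_⟩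
    rw [natDegree_eq_of_degree_eq (degree_eq_degree_of_associated hass),
      natDegree_map_eq_of_injective (RingHom.injective_int _), hdeg]
  have hHpos : ∀ β : ℂ, IsAlgebraic ℚ β → 0 < algHeight β ^ (-2 * Real.goldenRatio ^ 2) :=
    fun β hβ => Real.rpow_pos_of_pos (lt_of_lt_of_le one_pos (one_le_algHeight hβ)) _
  refine ⟨⟨c₂, hc₂, fun hfin => ?_⟩, ⟨min c₁ c₃ / 2, by positivity, fun β ha hdeg hle => ?_⟩⟩
  · -- the distances `‖ξ - α_k‖` are positive and tend to `0`, so they take infinitely many values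
    have hlim : Tendsto (fun k => ‖(ξ : ℂ) - α k‖) atTop (𝓝 0) := by
      obtain ⟨M, hM, hheight⟩ := h.exists_algHeight_rpow_bounds
      have h1 : Tendsto (fun k => c₂ * (M * ((Y (k + 1) : ℝ) ^ 2)⁻¹)) atTop (𝓝 (c₂ * (M * 0))) :=
        ((((tendsto_pow_atTop two_ne_zero).comp h.tendsto_succ).inv_tendsto_atTop).const_mul
          _).const_mul _
      rw [mul_zero, mul_zero] at h1
      refine squeeze_zero' (Eventually.of_forall fun _ => norm_nonneg _) ?_ h1
      filter_upwards [hheight, eventually_ge_atTop k₀] with k hk hk'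
      obtain ⟨-, -, ⟨hroot, -, hup⟩, -⟩ := hα k hk'
      refine hup.trans ?_
      gcongr
      exact (hk _ hroot).1
    obtain ⟨k, hk, hkS⟩ : ∃ k, k₀ ≤ k ∧ ∀ β ∈ {β : ℂ | IsAlgebraic ℚ β ∧
        (minpoly ℚ β).natDegree = 2 ∧
        ‖(ξ : ℂ) - β‖ ≤ c₂ * algHeight β ^ (-2 * Real.goldenRatio ^ 2)},
        0 < ‖(ξ : ℂ) - β‖ → ‖(ξ : ℂ) - α k‖ < ‖(ξ : ℂ) - β‖ := by
      have h1 := (eventually_all_finite hfin (l := atTop)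
        (p := fun β k => 0 < ‖(ξ : ℂ) - β‖ → ‖(ξ : ℂ) - α k‖ < ‖(ξ : ℂ) - β‖)).2 fun β _ => by
          by_cases h0 : 0 < ‖(ξ : ℂ) - β‖
          · filter_upwards [hlim.eventually_lt_const h0] with k hk _ using hk
          · exact Eventually.of_forall fun _ h => absurd h h0
      exact ((eventually_ge_atTop k₀).and h1).exists
    obtain ⟨-, -, ⟨-, hlow, hup⟩, -⟩ := hα k hk
    obtain ⟨ha, hd⟩ := halg k hk
    exact lt_irrefl _ (hkS (α k) ⟨ha, hd, hup⟩
      (lt_of_lt_of_le (mul_pos hc₁ (hHpos _ ha)) hlow))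
  · have hpos := hHpos β ha
    have hlt : min c₁ c₃ / 2 * algHeight β ^ (-2 * Real.goldenRatio ^ 2) <
        min c₁ c₃ * algHeight β ^ (-2 * Real.goldenRatio ^ 2) :=
      mul_lt_mul_of_pos_right (half_lt_self (lt_min hc₁ hc₃)) hpos
    by_cases hex : ∃ k, k₀ ≤ k ∧ β = α k
    · obtain ⟨k, hk, rfl⟩ := hex
      have h1 := (hα k hk).2.2.1.2.1
      have h2 : min c₁ c₃ * algHeight (α k) ^ (-2 * Real.goldenRatio ^ 2) ≤
        c₁ * algHeight (α k) ^ (-2 * Real.goldenRatio ^ 2) :=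
        mul_le_mul_of_nonneg_right (min_le_left _ _) hpos.le
      linarith
    · push Not at hex
      have h1 := hβ β ha hdeg hex
      have h2 : min c₁ c₃ * algHeight β ^ (-2 * Real.goldenRatio ^ 2) ≤
        c₃ * algHeight β ^ (-4 : ℤ) :=
        mul_le_mul (min_le_right _ _) (algHeight_rpow_le_zpow ha) hpos.le hc₃.le
      linarith

end QuadraticApproximation

/-! ### Minimal points -/

section MinimalPoints

open Filter Topology Matrix

variable {ξ : ℝ}

/-- The set of integral points with bounded first coordinate and bounded `L` is finite. -/
theorem finite_setOf_abs_le_ptL_le (ξ : ℝ) (N : ℤ) (M : ℝ) :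
    {z : Fin 3 → ℤ | |z 0| ≤ N ∧ ptL ξ z ≤ M}.Finite := by
  obtain ⟨B, hB⟩ := exists_int_gt (N * (1 + |ξ| + ξ ^ 2) + M)
  refine (Set.finite_Icc (fun _ => -B) (fun _ : Fin 3 => B)).subset fun z ⟨hz, hL⟩ => ?_
  have hz' : |(z 0 : ℝ)| ≤ N := by exact_mod_cast hz
  have hN : (0 : ℝ) ≤ N := (abs_nonneg _).trans hz'
  have hM : 0 ≤ M := (ptL_nonneg ξ z).trans hL
  have h1 : |(z 0 : ℝ) * ξ - z 1| ≤ M := (le_max_left _ _).trans hL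
  have h2 : |(z 0 : ℝ) * ξ ^ 2 - z 2| ≤ M := (le_max_right _ _).trans hL
  have b1 : |(z 0 : ℝ) * ξ| ≤ N * |ξ| := by rw [abs_mul]; gcongr
  have b2 : |(z 0 : ℝ) * ξ ^ 2| ≤ N * ξ ^ 2 := by
    rw [abs_mul, abs_of_nonneg (sq_nonneg ξ)]; gcongr
  have p1 : 0 ≤ N * |ξ| := by positivity
  have p2 : 0 ≤ N * ξ ^ 2 := by positivity
  have key : ∀ i, |(z i : ℝ)| < B := by
    intro i
    have e : N * (1 + |ξ| + ξ ^ 2) + M = N + N * |ξ| + N * ξ ^ 2 + M := by ring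
    rw [e] at hB
    rw [abs_le] at hz' h1 h2 b1 b2
    rw [abs_lt]
    fin_cases i
    · change -(B : ℝ) < z 0 ∧ (z 0 : ℝ) < B
      constructor <;> linarith
    · change -(B : ℝ) < z 1 ∧ (z 1 : ℝ) < B
      constructor <;> linarith
    · change -(B : ℝ) < z 2 ∧ (z 2 : ℝ) < B
      constructor <;> linarith
  have key' : ∀ i, |z i| < B := fun i => by exact_mod_cast key i
  exact ⟨fun i => (abs_lt.1 (key' i)).1.le, fun i => (abs_lt.1 (key' i)).2.le⟩

theorem exists_min_ptL (ξ : ℝ) {N : ℤ} (hN : 0 ≤ N) :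
    ∃ z : Fin 3 → ℤ, z ≠ 0 ∧ |z 0| ≤ N ∧
      ∀ w : Fin 3 → ℤ, w ≠ 0 → |w 0| ≤ N → ptL ξ z ≤ ptL ξ w := by
  let v : Fin 3 → ℤ := ![0, 0, 1]
  have hv : v ≠ 0 := fun h => by simpa [v] using congrFun h 2
  obtain ⟨z, ⟨⟨hz0, hz1, hz2⟩, hz⟩⟩ := Set.exists_min_image
    {z : Fin 3 → ℤ | z ≠ 0 ∧ |z 0| ≤ N ∧ ptL ξ z ≤ ptL ξ v} (ptL ξ)
    ((finite_setOf_abs_le_ptL_le ξ N (ptL ξ v)).subset fun z hz => hz.2)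
    ⟨v, hv, by simpa [v] using hN, le_rfl⟩
  refine ⟨z, hz0, hz1, fun w hw hwN => ?_⟩
  rcases le_total (ptL ξ w) (ptL ξ v) with h | h
  · exact hz w ⟨hw, hwN, h⟩
  · exact hz2.trans h

theorem ptL_pos (hξ : Irrational ξ) {z : Fin 3 → ℤ} (hz : z ≠ 0) : 0 < ptL ξ z := by
  rcases (ptL_nonneg ξ z).lt_or_eq with h | h
  · exact h
  exfalso
  have h1 : |(z 0 : ℝ) * ξ - z 1| ≤ 0 := h ▸ le_max_left _ _
  have h2 : |(z 0 : ℝ) * ξ ^ 2 - z 2| ≤ 0 := h ▸ le_max_right _ _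
  have h1' := abs_nonpos_iff.1 h1
  have h2' := abs_nonpos_iff.1 h2
  have h0 : z 0 = 0 := by
    by_contra h0
    exact (hξ.intCast_mul h0).ne_int (z 1) (sub_eq_zero.1 h1')
  rw [h0, Int.cast_zero, zero_mul, zero_sub, neg_eq_zero, Int.cast_eq_zero] at h1' h2'
  exact hz (by ext i; fin_cases i <;> assumption)

/-- A sequence of minimal points: the first coordinates increase in absolute value, the values of
`L` decrease, and `x_i` realizes the minimum of `L` among non-zero points whose first coordinate is
smaller than that of `x_{i+1}`. The last field is the extremality of `ξ`. -/
structure IsMinimalSeq (ξ C : ℝ) (x : ℕ → Fin 3 → ℤ) : Prop where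
  one_le : 1 ≤ |x 0 0|
  abs_lt : ∀ i, |x i 0| < |x (i + 1) 0|
  ptL_lt : ∀ i, ptL ξ (x (i + 1)) < ptL ξ (x i)
  le_ptL : ∀ i z, z ≠ 0 → |z 0| < |x (i + 1) 0| → ptL ξ (x i) ≤ ptL ξ z
  ptL_le : ∀ i, ptL ξ (x i) ≤ C * |(x (i + 1) 0 : ℝ)| ^ (-1 / Real.goldenRatio)

theorem exists_next_minimal_point (hξ : Irrational ξ)
    (happrox : ∀ ε : ℝ, 0 < ε → ∃ z : Fin 3 → ℤ, z ≠ 0 ∧ ptL ξ z < ε) {x : Fin 3 → ℤ} (hx0 : x ≠ 0)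
    (hx : ∀ w : Fin 3 → ℤ, w ≠ 0 → |w 0| ≤ |x 0| → ptL ξ x ≤ ptL ξ w) :
    ∃ x' : Fin 3 → ℤ, (x' ≠ 0 ∧ ∀ w : Fin 3 → ℤ, w ≠ 0 → |w 0| ≤ |x' 0| → ptL ξ x' ≤ ptL ξ w) ∧
      |x 0| < |x' 0| ∧ ptL ξ x' < ptL ξ x ∧
      ∀ w : Fin 3 → ℤ, w ≠ 0 → |w 0| < |x' 0| → ptL ξ x ≤ ptL ξ w := by
  classical
  have hex : ∃ N : ℕ, ∃ z : Fin 3 → ℤ, z ≠ 0 ∧ (z 0).natAbs = N ∧ ptL ξ z < ptL ξ x := by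
    obtain ⟨z, hz, hzL⟩ := happrox _ (ptL_pos hξ hx0)
    exact ⟨_, z, hz, rfl, hzL⟩
  obtain ⟨z, hz0, hzN, hzL⟩ := Nat.find_spec hex
  have hmin : ∀ w : Fin 3 → ℤ, w ≠ 0 → |w 0| < Nat.find hex → ptL ξ x ≤ ptL ξ w := by
    intro w hw hwN
    by_contra hcon
    rw [Int.abs_eq_natAbs, Nat.cast_lt] at hwN
    exact Nat.find_min hex hwN ⟨w, hw, rfl, not_le.1 hcon⟩
  generalize Nat.find hex = N at hzN hmin
  obtain ⟨x', h0, hN, h⟩ := exists_min_ptL ξ (Int.natCast_nonneg N)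
  have hlt : ptL ξ x' < ptL ξ x := (h z hz0 (by rw [Int.abs_eq_natAbs, hzN])).trans_lt hzL
  have hN' : |x' 0| = N := by
    refine le_antisymm hN (not_lt.1 fun hcon => ?_)
    exact absurd (hmin x' h0 hcon) (not_le.2 hlt)
  refine ⟨x', ⟨h0, fun w hw hwx => h w hw (hwx.trans hN)⟩, ?_, hlt, fun w hw hwx => ?_⟩
  · by_contra hcon
    exact absurd (hx x' h0 (not_lt.1 hcon)) (not_le.2 hlt)
  · exact hmin w hw (hN' ▸ hwx)

theorem IsExtremal.exists_isMinimalSeq (hξ : IsExtremal ξ) :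
    ∃ C : ℝ, 0 < C ∧ ∃ x, IsMinimalSeq ξ C x := by
  obtain ⟨hirr, -, c, hc, hX⟩ := hξ
  have hγ := Real.goldenRatio_pos
  have hX' : ∀ X : ℝ, 1 ≤ X → ∃ z : Fin 3 → ℤ, z ≠ 0 ∧ |(z 0 : ℝ)| ≤ X ∧
      ptL ξ z ≤ c * X ^ (-1 / Real.goldenRatio) := by
    intro X h1
    obtain ⟨a, b, d, hne, h0, h1, h2⟩ := hX X h1
    refine ⟨![a, b, d], fun h => hne ?_, h0, max_le h1 h2⟩
    have e0 := congrFun h 0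
    have e1 := congrFun h 1
    have e2 := congrFun h 2
    simp at e0 e1 e2
    simp [e0, e1, e2]
  have happrox : ∀ ε : ℝ, 0 < ε → ∃ z : Fin 3 → ℤ, z ≠ 0 ∧ ptL ξ z < ε := by
    intro ε hε
    have h1 : Tendsto (fun X : ℝ => c * X ^ (-(1 / Real.goldenRatio))) atTop (𝓝 (c * 0)) :=
      (tendsto_rpow_neg_atTop (by positivity)).const_mul c
    rw [mul_zero] at h1
    obtain ⟨X, hXε, hX1⟩ := ((h1.eventually_lt_const hε).and (eventually_ge_atTop 1)).exists
    obtain ⟨z, hz, -, hzL⟩ := hX' X hX1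
    refine ⟨z, hz, lt_of_le_of_lt hzL ?_⟩
    rwa [neg_div]
  let S := {x : Fin 3 → ℤ // x ≠ 0 ∧ ∀ w : Fin 3 → ℤ, w ≠ 0 → |w 0| ≤ |x 0| → ptL ξ x ≤ ptL ξ w}
  have hstep : ∀ x : S, ∃ x' : S, |x.1 0| < |x'.1 0| ∧ ptL ξ x'.1 < ptL ξ x.1 ∧
      ∀ w : Fin 3 → ℤ, w ≠ 0 → |w 0| < |x'.1 0| → ptL ξ x.1 ≤ ptL ξ w := by
    intro x
    obtain ⟨x', h1, h2⟩ := exists_next_minimal_point hirr happrox x.2.1 x.2.2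
    exact ⟨⟨x', h1⟩, h2⟩
  choose f hf1 hf2 hf3 using hstep
  obtain ⟨x₀, h0, hN, hmin⟩ := exists_min_ptL ξ le_rfl
  let s : S := ⟨x₀, h0, fun w hw hwx => hmin w hw (hwx.trans hN)⟩
  have hsucc : ∀ i, f^[i + 1] s = f (f^[i] s) := fun i => Function.iterate_succ_apply' f i s
  have hlt : ∀ i, |(f^[i] s).1 0| < |(f^[i + 1] s).1 0| := fun i => by
    rw [hsucc]; exact hf1 _
  refine ⟨c * 2 ^ (1 / Real.goldenRatio), by positivity, fun i => (f^[i + 1] s).1,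
    ⟨(abs_nonneg _).trans_lt (hlt 0), fun i => hlt (i + 1), fun i => ?_, fun i => ?_, fun i => ?_⟩⟩
  · rw [hsucc (i + 1)]; exact hf2 _
  · rw [hsucc (i + 1)]; exact hf3 _
  · -- the extremality condition is used with `X = |x_{i+1,0}| - 1`
    have hpos : 0 ≤ |(f^[i] s).1 0| := abs_nonneg _
    have h2 : 2 ≤ |(f^[i + 1 + 1] s).1 0| := by linarith [hlt i, hlt (i + 1)]
    have hmin' := hf3 (f^[i + 1] s)
    rw [← hsucc (i + 1)] at hmin'
    generalize (f^[i + 1 + 1] s).1 = x' at h2 hmin' ⊢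
    have h2' : (2 : ℝ) ≤ |(x' 0 : ℝ)| := by exact_mod_cast h2
    obtain ⟨z, hz, hzX, hzL⟩ := hX' (|(x' 0 : ℝ)| - 1) (by linarith)
    have hz' : |z 0| < |x' 0| := by
      have : |(z 0 : ℝ)| < |(x' 0 : ℝ)| := by linarith
      exact_mod_cast this
    refine ((hmin' z hz hz').trans hzL).trans ?_
    have h3 : (|(x' 0 : ℝ)| - 1) ^ (-1 / Real.goldenRatio) ≤
        (|(x' 0 : ℝ)| / 2) ^ (-1 / Real.goldenRatio) :=
      Real.rpow_le_rpow_of_nonpos (by linarith) (by linarith)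
        (div_nonpos_of_nonpos_of_nonneg (by norm_num) hγ.le)
    rw [mul_assoc]
    refine mul_le_mul_of_nonneg_left (h3.trans (le_of_eq ?_)) hc.le
    rw [Real.div_rpow (abs_nonneg _) zero_le_two, neg_div, Real.rpow_neg zero_le_two,
      div_inv_eq_mul, mul_comm]

namespace IsMinimalSeq

variable {C : ℝ} {x : ℕ → Fin 3 → ℤ}

theorem strictMono_abs (h : IsMinimalSeq ξ C x) : StrictMono fun i => |x i 0| :=
  strictMono_nat_of_lt_succ h.abs_lt

theorem strictAnti_ptL (h : IsMinimalSeq ξ C x) : StrictAnti fun i => ptL ξ (x i) :=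
  strictAnti_nat_of_succ_lt h.ptL_lt

theorem lt_abs (h : IsMinimalSeq ξ C x) (i : ℕ) : (i : ℤ) < |x i 0| := by
  induction i with
  | zero => exact lt_of_lt_of_le one_pos h.one_le
  | succ i ih => push_cast; linarith [h.abs_lt i]

theorem one_le_abs (h : IsMinimalSeq ξ C x) (i : ℕ) : (1 : ℝ) ≤ |(x i 0 : ℝ)| := by
  have : 1 ≤ |x i 0| := by have := h.lt_abs i; omega
  exact_mod_cast this

theorem ne_zero (h : IsMinimalSeq ξ C x) (i : ℕ) : x i ≠ 0 := fun h0 => by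
  have := h.lt_abs i
  rw [h0] at this
  simp at this
  omega

theorem tendsto_abs (h : IsMinimalSeq ξ C x) :
    Tendsto (fun i => |(x i 0 : ℝ)|) atTop atTop := by
  refine tendsto_atTop_mono (fun i => ?_) tendsto_natCast_atTop_atTop
  exact_mod_cast (h.lt_abs i).le

/-- As `2 / γ > 1`, the quantity `|x_{i+1,0}| L(x_i) ^ 2` tends to `0`. -/
theorem tendsto_abs_mul_sq (h : IsMinimalSeq ξ C x) :
    Tendsto (fun i => |(x (i + 1) 0 : ℝ)| * ptL ξ (x i) ^ 2) atTop (𝓝 0) := by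
  have hγ := Real.goldenRatio_pos
  have h1 : Tendsto (fun i => C ^ 2 * |(x (i + 1) 0 : ℝ)| ^ (-(2 / Real.goldenRatio - 1))) atTop
      (𝓝 (C ^ 2 * 0)) := by
    refine ((tendsto_rpow_neg_atTop ?_).comp
      (h.tendsto_abs.comp (tendsto_add_atTop_nat 1))).const_mul _
    rw [sub_pos, one_lt_div hγ]; exact Real.goldenRatio_lt_two
  rw [mul_zero] at h1
  refine squeeze_zero (fun i => by positivity) (fun i => ?_) h1
  have hpos : 0 < |(x (i + 1) 0 : ℝ)| := zero_lt_one.trans_le (h.one_le_abs _)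
  calc |(x (i + 1) 0 : ℝ)| * ptL ξ (x i) ^ 2
      ≤ |(x (i + 1) 0 : ℝ)| * (C * |(x (i + 1) 0 : ℝ)| ^ (-1 / Real.goldenRatio)) ^ 2 := by
        gcongr
        · exact ptL_nonneg _ _
        · exact h.ptL_le i
    _ = C ^ 2 * (|(x (i + 1) 0 : ℝ)| ^ (1 : ℝ) *
          |(x (i + 1) 0 : ℝ)| ^ (-1 / Real.goldenRatio * (2 : ℕ))) := by
        rw [mul_pow, Real.rpow_mul_natCast hpos.le, Real.rpow_one]; ring
    _ = _ := by
        rw [← Real.rpow_add hpos]; congr 2; push_cast; ring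

theorem tendsto_ptL (h : IsMinimalSeq ξ C x) :
    Tendsto (fun i => ptL ξ (x i)) atTop (𝓝 0) := by
  have h1 : Tendsto (fun i => ptL ξ (x i) ^ 2) atTop (𝓝 0) := by
    refine squeeze_zero (fun i => by positivity) (fun i => ?_) h.tendsto_abs_mul_sq
    nlinarith [h.one_le_abs (i + 1), sq_nonneg (ptL ξ (x i))]
  have h2 := h1.sqrt
  rw [Real.sqrt_zero] at h2
  exact h2.congr fun i => Real.sqrt_sq (ptL_nonneg _ _)

end IsMinimalSeq

end MinimalPoints

/-! ### Planes spanned by minimal points -/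

section IntegralPoints

open Filter Topology Matrix

variable {ξ : ℝ}

/-- Two integral points, one with a smaller first coordinate and a larger `L`, are not
proportional. -/
theorem cross_ne_zero_of_lt {z x : Fin 3 → ℤ} (hN : |z 0| < |x 0|) (hL : ptL ξ x < ptL ξ z) :
    crossProduct z x ≠ 0 := by
  intro h0
  have h1 : z 0 * x 1 = z 1 * x 0 := by
    have := congrFun h0 2
    simp [cross_apply] at this
    linarith
  have h2 : z 0 * x 2 = z 2 * x 0 := by
    have := congrFun h0 1
    simp [cross_apply] at this
    linarith
  have h1' : (z 0 : ℝ) * x 1 = z 1 * x 0 := by exact_mod_cast h1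
  have h2' : (z 0 : ℝ) * x 2 = z 2 * x 0 := by exact_mod_cast h2
  have key : |(x 0 : ℝ)| * ptL ξ z = |(z 0 : ℝ)| * ptL ξ x := by
    rw [ptL, ptL, mul_max_of_nonneg _ _ (abs_nonneg _), mul_max_of_nonneg _ _ (abs_nonneg _),
      ← abs_mul, ← abs_mul, ← abs_mul, ← abs_mul]
    congr 2
    · linear_combination h1'
    · linear_combination h2'
  have hN' : |(z 0 : ℝ)| < |(x 0 : ℝ)| := by exact_mod_cast hN
  nlinarith [ptL_nonneg ξ x, abs_nonneg (z 0 : ℝ)]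

/-- Cramer's rule: a vector orthogonal to `x × y` is a combination of `x` and `y`, up to the factor
`‖x × y‖²`. -/
theorem cross_dot_self_mul (x y z : Fin 3 → ℤ) (h : z ⬝ᵥ crossProduct x y = 0) (j : Fin 3) :
    (crossProduct x y ⬝ᵥ crossProduct x y) * z j =
      (crossProduct z y ⬝ᵥ crossProduct x y) * x j
        + (crossProduct x z ⬝ᵥ crossProduct x y) * y j := by
  have key : (crossProduct x y ⬝ᵥ crossProduct x y) * z j =
      (crossProduct z y ⬝ᵥ crossProduct x y) * x j
        + (crossProduct x z ⬝ᵥ crossProduct x y) * y j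
        + (z ⬝ᵥ crossProduct x y) * crossProduct x y j := by
    simp only [vec3_dotProduct, cross_apply]
    fin_cases j <;> simp <;> ring
  rw [key, h, zero_mul, add_zero]

theorem ptL_combination_le {D p q : ℝ} {t x y : Fin 3 → ℤ}
    (h : ∀ j, D * t j = p * x j + q * y j) :
    |D| * ptL ξ t ≤ |p| * ptL ξ x + |q| * ptL ξ y := by
  rw [ptL, mul_max_of_nonneg _ _ (abs_nonneg _)]
  refine max_le ?_ ?_
  · have e : D * (t 0 * ξ - t 1) = p * (x 0 * ξ - x 1) + q * (y 0 * ξ - y 1) := by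
      linear_combination ξ * h 0 - h 1
    rw [← abs_mul, e]
    refine (abs_add_le _ _).trans ?_
    rw [abs_mul, abs_mul]
    gcongr <;> exact le_max_left _ _
  · have e : D * (t 0 * ξ ^ 2 - t 2) = p * (x 0 * ξ ^ 2 - x 2) + q * (y 0 * ξ ^ 2 - y 2) := by
      linear_combination ξ ^ 2 * h 0 - h 2
    rw [← abs_mul, e]
    refine (abs_add_le _ _).trans ?_
    rw [abs_mul, abs_mul]
    gcongr <;> exact le_max_right _ _

theorem exists_abs_sub_mul_le (p : ℤ) {D : ℤ} (hD : 0 < D) :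
    ∃ r : ℤ, |((p - r * D : ℤ) : ℝ)| ≤ D / 2 := by
  have hD' : (0 : ℝ) < D := by exact_mod_cast hD
  refine ⟨round ((p : ℝ) / D), ?_⟩
  have h := abs_sub_round ((p : ℝ) / D)
  have e : ((p - round ((p : ℝ) / D) * D : ℤ) : ℝ) = D * ((p : ℝ) / D - round ((p : ℝ) / D)) := by
    push_cast; field_simp
  rw [e, abs_mul, abs_of_pos hD']
  nlinarith

namespace IsMinimalSeq

variable {C : ℝ} {x : ℕ → Fin 3 → ℤ}

theorem cross_ne_zero (h : IsMinimalSeq ξ C x) {i j : ℕ} (hij : i < j) :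
    crossProduct (x i) (x j) ≠ 0 :=
  cross_ne_zero_of_lt (h.strictMono_abs hij) (h.strictAnti_ptL hij)

/-- Two consecutive minimal points form a basis of the lattice of integral points in the plane that
they span: a combination with coefficients at most `1 / 2` in absolute value would contradict
minimality. -/
theorem exists_eq_combination (h : IsMinimalSeq ξ C x) (i : ℕ) {z : Fin 3 → ℤ}
    (hz : z ⬝ᵥ crossProduct (x i) (x (i + 1)) = 0) :
    ∃ r s : ℤ, z = r • x i + s • x (i + 1) := by
  have hw := h.cross_ne_zero (Nat.lt_succ_self i)
  have hcr := cross_dot_self_mul _ _ _ hz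
  have hN : |(x i 0 : ℝ)| < |(x (i + 1) 0 : ℝ)| := by exact_mod_cast h.abs_lt i
  have hL := h.ptL_lt i
  have hle := h.le_ptL i
  obtain ⟨D, hD⟩ : ∃ D, D = crossProduct (x i) (x (i + 1)) ⬝ᵥ crossProduct (x i) (x (i + 1)) :=
    ⟨_, rfl⟩
  have hDpos : 0 < D := by
    obtain ⟨j, hj⟩ := Function.ne_iff.1 hw
    rw [hD]
    exact Finset.sum_pos' (fun j _ => mul_self_nonneg _)
      ⟨j, Finset.mem_univ _, mul_self_pos.2 hj⟩
  rw [← hD] at hcr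
  obtain ⟨r, hr⟩ := exists_abs_sub_mul_le
    (crossProduct z (x (i + 1)) ⬝ᵥ crossProduct (x i) (x (i + 1))) hDpos
  obtain ⟨s, hs⟩ := exists_abs_sub_mul_le
    (crossProduct (x i) z ⬝ᵥ crossProduct (x i) (x (i + 1))) hDpos
  generalize crossProduct z (x (i + 1)) ⬝ᵥ crossProduct (x i) (x (i + 1)) = p at hcr hr
  generalize crossProduct (x i) z ⬝ᵥ crossProduct (x i) (x (i + 1)) = q at hcr hs
  refine ⟨r, s, ?_⟩
  by_contra hne
  obtain ⟨t, ht⟩ : ∃ t, t = z - (r • x i + s • x (i + 1)) := ⟨_, rfl⟩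
  have ht0 : t ≠ 0 := fun h0 => hne (sub_eq_zero.1 (ht ▸ h0))
  have hcomb : ∀ j, (D : ℝ) * t j =
      ((p - r * D : ℤ) : ℝ) * x i j + ((q - s * D : ℤ) : ℝ) * x (i + 1) j := by
    intro j
    have h1 : D * t j = (p - r * D) * x i j + (q - s * D) * x (i + 1) j := by
      rw [ht]; simp; linear_combination hcr j
    exact_mod_cast h1
  have hD' : (0 : ℝ) < D := by exact_mod_cast hDpos
  have hx0 : |(t 0 : ℝ)| < |(x (i + 1) 0 : ℝ)| := by
    have h1 : |(D : ℝ)| * |(t 0 : ℝ)| ≤ D / 2 * |(x i 0 : ℝ)| + D / 2 * |(x (i + 1) 0 : ℝ)| := by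
      rw [← abs_mul, hcomb 0]
      refine (abs_add_le _ _).trans ?_
      rw [abs_mul, abs_mul]
      gcongr
    rw [abs_of_pos hD'] at h1
    nlinarith
  have hxL : ptL ξ t < ptL ξ (x i) := by
    have h1 := (ptL_combination_le (ξ := ξ) hcomb)
    rw [abs_of_pos hD'] at h1
    have h2 := mul_le_mul_of_nonneg_right hr (ptL_nonneg ξ (x i))
    have h3 := mul_le_mul_of_nonneg_right hs (ptL_nonneg ξ (x (i + 1)))
    nlinarith
  exact absurd (hle t ht0 (by exact_mod_cast hx0)) (not_le.2 hxL)

/-- As long as consecutive minimal points stay in one plane, the products `x_i × x_{i+1}` agree up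
to sign. -/
theorem cross_succ_eq (h : IsMinimalSeq ξ C x) {i : ℕ}
    (hi : det3 (x i) (x (i + 1)) (x (i + 2)) = 0) :
    crossProduct (x (i + 1)) (x (i + 2)) = crossProduct (x i) (x (i + 1)) ∨
      crossProduct (x (i + 1)) (x (i + 2)) = -crossProduct (x i) (x (i + 1)) := by
  rw [det3_eq_dot_cross] at hi
  obtain ⟨r', s', h1⟩ := h.exists_eq_combination (i + 1) hi
  rw [triple_product_permutation, triple_product_permutation] at hi
  obtain ⟨r, s, h2⟩ := h.exists_eq_combination i hi
  have hw := h.cross_ne_zero (Nat.lt_succ_self i)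
  have e1 : crossProduct (x (i + 1)) (x (i + 2)) = -r • crossProduct (x i) (x (i + 1)) := by
    rw [h2, map_add, map_smul, map_smul, cross_self, smul_zero, add_zero,
      ← cross_anticomm (x i), smul_neg, neg_smul]
  have e2 : crossProduct (x i) (x (i + 1)) = -s' • crossProduct (x (i + 1)) (x (i + 2)) := by
    conv_lhs => rw [h1]
    rw [map_add, map_smul, map_smul, LinearMap.add_apply, LinearMap.smul_apply,
      LinearMap.smul_apply, cross_self, smul_zero, zero_add, ← cross_anticomm (x (i + 1)), smul_neg,
      neg_smul]
  have e3 : (1 - s' * r) • crossProduct (x i) (x (i + 1)) = 0 := by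
    rw [sub_smul, one_smul, sub_eq_zero]
    conv_lhs => rw [e2, e1]
    rw [smul_smul, neg_mul_neg]
  have hrs : s' * r = 1 := by
    rcases smul_eq_zero.1 e3 with h | h
    · linarith
    · exact absurd h hw
  rcases Int.eq_one_or_neg_one_of_mul_eq_one' hrs with ⟨-, rfl⟩ | ⟨-, rfl⟩
  · right; rw [e1]; simp
  · left; rw [e1]; simp

/-- If `det x = 0`, then `x` is a multiple of a point `(m², mn, n²)` with `n / m` close to `ξ`. The
preceding minimal point `z` satisfies `|z₀ n - z₁ m| < 1` and `|z₁ n - z₂ m| < 1` when `x` is large,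
which makes it proportional to `x`. -/
theorem eventually_symDet_ne_zero (h : IsMinimalSeq ξ C x) :
    ∀ᶠ i in atTop, symDet (x i) ≠ 0 := by
  obtain ⟨A, hA⟩ : ∃ A, A = 2 + 4 * |ξ| + ptL ξ (x 0) := ⟨_, rfl⟩
  have hA0 : 0 < A := by rw [hA]; have := ptL_nonneg ξ (x 0); positivity
  rw [← map_add_atTop_eq_nat 1, eventually_map]
  filter_upwards [h.tendsto_abs_mul_sq.eventually_lt_const (show 0 < (A ^ 2)⁻¹ by positivity)]
    with i hi hdet
  have hN := h.abs_lt i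
  have hL := h.ptL_lt i
  have hL0 : ptL ξ (x i) ≤ ptL ξ (x 0) := h.strictAnti_ptL.antitone (Nat.zero_le i)
  have hx0 : x (i + 1) 0 ≠ 0 := by
    intro h0
    have := h.lt_abs (i + 1)
    rw [h0, abs_zero] at this
    omega
  have hcr := cross_ne_zero_of_lt hN hL
  generalize x (i + 1) = p at *
  generalize x i = z at *
  rw [symDet, sub_eq_zero] at hdet
  obtain ⟨m, n, hmn, hm, hn⟩ := Int.exists_gcd_one (Int.gcd_pos_of_ne_zero_left (p 1) hx0)
  generalize ((p 0).gcd (p 1) : ℤ) = g at hm hn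
  have hg0 : g ≠ 0 := by rintro rfl; simp at hm; exact hx0 hm
  have hm0 : m ≠ 0 := by rintro rfl; simp at hm; exact hx0 hm
  have h1 : m * p 2 = n ^ 2 * g := by
    refine mul_left_cancel₀ hg0 ?_
    rw [hm, hn] at hdet; linear_combination hdet
  obtain ⟨k, rfl⟩ : m ∣ g :=
    ((Int.isCoprime_iff_gcd_eq_one.2 hmn).pow_right (n := 2)).dvd_of_dvd_mul_left ⟨p 2, h1.symm⟩
  have hk0 : k ≠ 0 := by rintro rfl; simp at hg0
  have h2 : p 2 = k * n ^ 2 := mul_left_cancel₀ hm0 (by linear_combination h1)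
  have h0 : p 0 = k * m ^ 2 := by rw [hm]; ring
  have h1' : p 1 = k * m * n := by rw [hn]; ring
  -- `δ = |n - ξ m|` satisfies `|k m| δ ≤ L(z)`, and `|z₀| ≤ |p₀| = |k| m²`
  have hkm : (1 : ℝ) ≤ |(k * m : ℝ)| := by
    have := Int.one_le_abs (mul_ne_zero hk0 hm0)
    exact_mod_cast this
  have hk1 : (1 : ℝ) ≤ |(k : ℝ)| := by exact_mod_cast Int.one_le_abs hk0
  have hm1 : (1 : ℝ) ≤ |(m : ℝ)| := by exact_mod_cast Int.one_le_abs hm0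
  have hδ : |(k * m : ℝ)| * |n - ξ * m| ≤ ptL ξ z := by
    refine le_trans (le_trans (le_of_eq ?_) (abs_linErr_le ξ p)) hL.le
    rw [← abs_mul, linErr, h0, h1']; push_cast; congr 1; ring
  have hδ1 : |n - ξ * m| ≤ ptL ξ z := by
    refine le_trans ?_ hδ
    exact le_mul_of_one_le_left (abs_nonneg _) hkm
  have hNδ : |(z 0 : ℝ)| * |n - ξ * m| ≤ |(m : ℝ)| * ptL ξ z := by
    have hN' : |(z 0 : ℝ)| ≤ |(p 0 : ℝ)| := by exact_mod_cast hN.le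
    have e : |(p 0 : ℝ)| = |(m : ℝ)| * |(k * m : ℝ)| := by
      rw [h0, ← abs_mul]; push_cast; congr 1; ring
    calc _ ≤ |(p 0 : ℝ)| * |n - ξ * m| := by gcongr
      _ = |(m : ℝ)| * (|(k * m : ℝ)| * |n - ξ * m|) := by rw [e]; ring
      _ ≤ _ := by gcongr
  have hLz := ptL_nonneg ξ z
  have he := abs_linErr_le ξ z
  have hf := abs_quadErr_le ξ z
  have hsmall : A * (|(m : ℝ)| * ptL ξ z) < 1 := by
    have e : |(p 0 : ℝ)| = |(k : ℝ)| * |(m : ℝ)| ^ 2 := by rw [h0]; push_cast; rw [abs_mul, abs_pow]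
    have h3 : (A * (|(m : ℝ)| * ptL ξ z)) ^ 2 < 1 := by
      calc (A * (|(m : ℝ)| * ptL ξ z)) ^ 2 = A ^ 2 * (1 * |(m : ℝ)| ^ 2 * ptL ξ z ^ 2) := by ring
        _ ≤ A ^ 2 * (|(k : ℝ)| * |(m : ℝ)| ^ 2 * ptL ξ z ^ 2) := by gcongr
        _ < A ^ 2 * (A ^ 2)⁻¹ := by rw [← e]; gcongr
        _ = 1 := mul_inv_cancel₀ (by positivity)
    exact (sq_lt_one_iff₀ (by positivity)).1 h3
  have hmL : 0 ≤ |(m : ℝ)| * ptL ξ z := by positivity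
  have hLm : ptL ξ z ≤ |(m : ℝ)| * ptL ξ z := le_mul_of_one_le_left hLz hm1
  have z1 : z 0 * n - z 1 * m = 0 := by
    refine Int.abs_lt_one_iff.1 ?_
    have : |((z 0 * n - z 1 * m : ℤ) : ℝ)| < 1 := by
      have e : ((z 0 * n - z 1 * m : ℤ) : ℝ) = z 0 * (n - ξ * m) - m * linErr ξ z := by
        rw [linErr]; push_cast; ring
      rw [e]
      refine lt_of_le_of_lt ((abs_sub _ _).trans ?_) hsmall
      rw [abs_mul, abs_mul]
      have h4 : |(m : ℝ)| * |linErr ξ z| ≤ |(m : ℝ)| * ptL ξ z := by gcongr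
      rw [hA]
      have := ptL_nonneg ξ (x 0)
      have h5 : 0 ≤ (4 * |ξ| + ptL ξ (x 0)) * (|(m : ℝ)| * ptL ξ z) := by positivity
      linarith
    exact_mod_cast this
  have z2 : z 1 * n - z 2 * m = 0 := by
    refine Int.abs_lt_one_iff.1 ?_
    have : |((z 1 * n - z 2 * m : ℤ) : ℝ)| < 1 := by
      have e : ((z 1 * n - z 2 * m : ℤ) : ℝ) = ξ * (z 0 * (n - ξ * m)) + linErr ξ z * (n - ξ * m)
          - (m * quadErr ξ z + ξ * (m * linErr ξ z)) := by
        rw [linErr, quadErr]; push_cast; ring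
      rw [e]
      refine lt_of_le_of_lt ((abs_sub _ _).trans (add_le_add (abs_add_le _ _) (abs_add_le _ _)))
        (lt_of_le_of_lt ?_ hsmall)
      simp only [abs_mul]
      have h4 : |(m : ℝ)| * |linErr ξ z| ≤ |(m : ℝ)| * ptL ξ z := by gcongr
      have h5 : |ξ| * (|(m : ℝ)| * |linErr ξ z|) ≤ |ξ| * (|(m : ℝ)| * ptL ξ z) := by gcongr
      have h6 : |(m : ℝ)| * |quadErr ξ z| ≤ |(m : ℝ)| * ((1 + 2 * |ξ|) * ptL ξ z) := by gcongr
      have h7 : |ξ| * (|(z 0 : ℝ)| * |n - ξ * m|) ≤ |ξ| * (|(m : ℝ)| * ptL ξ z) := by gcongr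
      have h8 : |linErr ξ z| * |n - ξ * m| ≤ ptL ξ (x 0) * (|(m : ℝ)| * ptL ξ z) :=
        mul_le_mul (he.trans hL0) (hδ1.trans hLm) (abs_nonneg _) (ptL_nonneg ξ (x 0))
      rw [hA]
      linarith
    exact_mod_cast this
  refine hcr ?_
  rw [cross_apply, h0, h1', h2]
  ext j
  fin_cases j <;> simp
  · linear_combination k * n * z2
  · linear_combination -k * n * z1 - k * m * z2
  · linear_combination k * m * z1

end IsMinimalSeq

/-- An extremal number satisfies no quadratic equation with integral coefficients. -/
theorem IsExtremal.eq_zero_of_quadratic (hξ : IsExtremal ξ) {u : Fin 3 → ℤ}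
    (h : u 0 + u 1 * ξ + u 2 * ξ ^ 2 = 0) : u = 0 := by
  obtain ⟨hirr, hquad, -⟩ := hξ
  have h2 : u 2 = 0 := by
    by_contra h2
    obtain ⟨P, hP⟩ : ∃ P : ℚ[X], P = C (u 2 : ℚ) * X ^ 2 + C (u 1 : ℚ) * X + C (u 0 : ℚ) := ⟨_, rfl⟩
    have hdeg : P.natDegree = 2 := by rw [hP]; exact natDegree_quadratic (by exact_mod_cast h2)
    have hP0 : P ≠ 0 := by rintro rfl; simp at hdeg
    have hroot : aeval ξ P = 0 := by
      rw [hP]; simp; linarith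
    have halg : IsAlgebraic ℚ ξ := ⟨P, hP0, hroot⟩
    have hle : (minpoly ℚ ξ).natDegree ≤ 2 := hdeg ▸ natDegree_le_of_dvd (minpoly.dvd _ _ hroot) hP0
    have hpos := minpoly.natDegree_pos halg.isIntegral
    have hne2 : (minpoly ℚ ξ).natDegree ≠ 2 := fun h => hquad ⟨halg, h⟩
    obtain ⟨q, hq⟩ := minpoly.natDegree_eq_one_iff.1 (show (minpoly ℚ ξ).natDegree = 1 by omega)
    exact hirr ⟨q, by simpa using hq⟩
  have h1 : u 1 = 0 := by
    by_contra h1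
    rw [h2, Int.cast_zero, zero_mul, add_zero] at h
    exact (hirr.intCast_mul h1).ne_int (-u 0) (by push_cast; linarith)
  have h0 : u 0 = 0 := by
    rw [h2, h1, Int.cast_zero, zero_mul, zero_mul, add_zero, add_zero] at h
    exact_mod_cast h
  ext j; fin_cases j <;> assumption

/-- The minimal points do not eventually stay in one plane, since `1, ξ, ξ²` are linearly
independent over `ℚ`. -/
theorem IsMinimalSeq.frequently_det3_ne_zero {C : ℝ} {x : ℕ → Fin 3 → ℤ} (hξ : IsExtremal ξ)
    (h : IsMinimalSeq ξ C x) : ∃ᶠ i in atTop, det3 (x i) (x (i + 1)) (x (i + 2)) ≠ 0 := by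
  intro hcon
  obtain ⟨M, hM⟩ := eventually_atTop.1 hcon
  obtain ⟨w, hw⟩ : ∃ w, w = crossProduct (x M) (x (M + 1)) := ⟨_, rfl⟩
  have hall : ∀ i, M ≤ i → crossProduct (x i) (x (i + 1)) = w ∨
      crossProduct (x i) (x (i + 1)) = -w := by
    intro i hi
    induction i, hi using Nat.le_induction with
    | base => exact Or.inl hw.symm
    | succ i hi ih =>
      have h0 : det3 (x i) (x (i + 1)) (x (i + 2)) = 0 := by
        by_contra hne; exact hM i hi hne
      rcases h.cross_succ_eq h0 with h1 | h1 <;> rcases ih with h2 | h2 <;> rw [h2] at h1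
      · exact Or.inl h1
      · exact Or.inr h1
      · exact Or.inr h1
      · exact Or.inl (by rw [h1, neg_neg])
  have horth : ∀ i, M ≤ i → x i ⬝ᵥ w = 0 := by
    intro i hi
    have h1 := dot_self_cross (x i) (x (i + 1))
    rcases hall i hi with h2 | h2 <;> rw [h2] at h1
    · exact h1
    · rwa [dotProduct_neg, neg_eq_zero] at h1
  have hlim : Tendsto (fun i => (|(w 1 : ℝ)| + |(w 2 : ℝ)|) * ptL ξ (x i)) atTop (𝓝 0) := by
    have := h.tendsto_ptL.const_mul (|(w 1 : ℝ)| + |(w 2 : ℝ)|)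
    rwa [mul_zero] at this
  have hle : |w 0 + w 1 * ξ + w 2 * ξ ^ 2| ≤ 0 := by
    refine ge_of_tendsto hlim ?_
    filter_upwards [eventually_ge_atTop M] with i hi
    have h1 : (x i 0 : ℝ) * w 0 + x i 1 * w 1 + x i 2 * w 2 = 0 := by
      have := horth i hi
      rw [vec3_dotProduct] at this
      exact_mod_cast this
    have e : (x i 0 : ℝ) * (w 0 + w 1 * ξ + w 2 * ξ ^ 2)
        = w 1 * (x i 0 * ξ - x i 1) + w 2 * (x i 0 * ξ ^ 2 - x i 2) := by
      linear_combination h1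
    calc |w 0 + w 1 * ξ + w 2 * ξ ^ 2|
        ≤ |(x i 0 : ℝ)| * |w 0 + w 1 * ξ + w 2 * ξ ^ 2| :=
          le_mul_of_one_le_left (abs_nonneg _) (h.one_le_abs i)
      _ ≤ |(w 1 : ℝ)| * ptL ξ (x i) + |(w 2 : ℝ)| * ptL ξ (x i) := by
          rw [← abs_mul, e]
          refine (abs_add_le _ _).trans ?_
          rw [abs_mul, abs_mul]
          gcongr
          · exact le_max_left _ _
          · exact le_max_right _ _
      _ = _ := by ring
  have h0 := hξ.eq_zero_of_quadratic (abs_nonpos_iff.1 hle)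
  exact h.cross_ne_zero (Nat.lt_succ_self M) (hw.symm.trans h0)

/-- A criterion for three integral points to be linearly independent: the planes orthogonal to `u`
and `w`, spanned by `p, q` and by `q, r`, are different because `t` lies in only one of them. -/
theorem dot_cross_ne_zero {p q r u w t : Fin 3 → ℤ} (hpu : u ⬝ᵥ p = 0) (hqu : u ⬝ᵥ q = 0)
    (hqw : w ⬝ᵥ q = 0) (hrw : w ⬝ᵥ r = 0) (hpq : crossProduct p q ≠ 0)
    (hqr : crossProduct q r ≠ 0) (hw : w ≠ 0) (htw : t ⬝ᵥ w = 0) (htu : t ⬝ᵥ u ≠ 0) :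
    p ⬝ᵥ crossProduct q r ≠ 0 := by
  have key : ∀ {a b v : Fin 3 → ℤ}, v ⬝ᵥ a = 0 → v ⬝ᵥ b = 0 → ∀ (s : Fin 3 → ℤ) (i : Fin 3),
      v i * (s ⬝ᵥ crossProduct a b) = crossProduct a b i * (s ⬝ᵥ v) := by
    intro a b v ha hb s i
    have h := mul_cross_eq_mul_of_dotProduct_eq_zero ha hb i
    rw [vec3_dotProduct, vec3_dotProduct]
    linear_combination s 0 * h 0 + s 1 * h 1 + s 2 * h 2
  intro h0
  have hpw : w ⬝ᵥ p = 0 := by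
    obtain ⟨i, hi⟩ := Function.ne_iff.1 hqr
    have h1 := key hqw hrw p i
    rw [h0, mul_zero] at h1
    rw [dotProduct_comm]
    exact (mul_eq_zero.1 h1.symm).resolve_left hi
  obtain ⟨i, hi⟩ := Function.ne_iff.1 hpq
  have htc : t ⬝ᵥ crossProduct p q = 0 := by
    obtain ⟨j, hj⟩ := Function.ne_iff.1 hw
    have h1 := key hpw hqw t j
    rw [htw, mul_zero] at h1
    exact (mul_eq_zero.1 h1).resolve_left hj
  have h1 := key hpu hqu t i
  rw [htc, mul_zero] at h1
  exact htu ((mul_eq_zero.1 h1.symm).resolve_left hi)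

end IntegralPoints

/-! ### Existence of the sequence `y_k` -/

section Existence

open Filter Topology Matrix

variable {ξ : ℝ}

theorem abs_symDet_le (ξ : ℝ) (x : Fin 3 → ℤ) :
    |(symDet x : ℝ)| ≤ |(x 0 : ℝ)| * ((1 + 2 * |ξ|) * ptL ξ x) + ptL ξ x ^ 2 := by
  rw [symDet_eq_err ξ]
  refine (abs_sub _ _).trans ?_
  rw [abs_mul, abs_pow]
  gcongr
  · exact abs_quadErr_le ξ x
  · exact abs_linErr_le ξ x

theorem abs_det3_le {x y z : Fin 3 → ℤ} (hxy : |x 0| ≤ |y 0|) (hyz : |y 0| ≤ |z 0|)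
    (hLxy : ptL ξ y ≤ ptL ξ x) (hLyz : ptL ξ z ≤ ptL ξ y) :
    |(det3 x y z : ℝ)| ≤ 6 * (1 + 2 * |ξ|) * (|(z 0 : ℝ)| * ptL ξ x * ptL ξ y) := by
  have hxy' : |(x 0 : ℝ)| ≤ |(y 0 : ℝ)| := by exact_mod_cast hxy
  have hyz' : |(y 0 : ℝ)| ≤ |(z 0 : ℝ)| := by exact_mod_cast hyz
  have hxz' := hxy'.trans hyz'
  have ex := abs_linErr_le ξ x
  have ey := abs_linErr_le ξ y
  have ez := abs_linErr_le ξ z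
  have fx := abs_quadErr_le ξ x
  have fy := abs_quadErr_le ξ y
  have fz := abs_quadErr_le ξ z
  have hx := ptL_nonneg ξ x
  have hy := ptL_nonneg ξ y
  have hz := ptL_nonneg ξ z
  have hM : 0 ≤ 1 + 2 * |ξ| := by positivity
  rw [det3_eq_err ξ]
  generalize 1 + 2 * |ξ| = M at *
  have t1 : |(z 0 : ℝ) * (linErr ξ x * quadErr ξ y)| ≤ M * (|(z 0 : ℝ)| * ptL ξ x * ptL ξ y) := by
    rw [abs_mul, abs_mul]
    calc _ ≤ |(z 0 : ℝ)| * (ptL ξ x * (M * ptL ξ y)) := by gcongr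
      _ = _ := by ring
  have t2 : |(z 0 : ℝ) * (quadErr ξ x * linErr ξ y)| ≤ M * (|(z 0 : ℝ)| * ptL ξ x * ptL ξ y) := by
    rw [abs_mul, abs_mul]
    calc _ ≤ |(z 0 : ℝ)| * ((M * ptL ξ x) * ptL ξ y) := by gcongr
      _ = _ := by ring
  have t3 : |linErr ξ z * (y 0 * quadErr ξ x)| ≤ M * (|(z 0 : ℝ)| * ptL ξ x * ptL ξ y) := by
    rw [abs_mul, abs_mul]
    calc _ ≤ ptL ξ y * (|(z 0 : ℝ)| * (M * ptL ξ x)) := by gcongr; exact ez.trans hLyz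
      _ = _ := by ring
  have t4 : |linErr ξ z * (x 0 * quadErr ξ y)| ≤ M * (|(z 0 : ℝ)| * ptL ξ x * ptL ξ y) := by
    rw [abs_mul, abs_mul]
    calc _ ≤ ptL ξ x * (|(z 0 : ℝ)| * (M * ptL ξ y)) := by
          gcongr
          exact ez.trans (hLyz.trans hLxy)
      _ = _ := by ring
  have t5 : |quadErr ξ z * (x 0 * linErr ξ y)| ≤ M * (|(z 0 : ℝ)| * ptL ξ x * ptL ξ y) := by
    rw [abs_mul, abs_mul]
    calc _ ≤ (M * ptL ξ x) * (|(z 0 : ℝ)| * ptL ξ y) := by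
          gcongr
          exact fz.trans (by gcongr; exact hLyz.trans hLxy)
      _ = _ := by ring
  have t6 : |quadErr ξ z * (linErr ξ x * y 0)| ≤ M * (|(z 0 : ℝ)| * ptL ξ x * ptL ξ y) := by
    rw [abs_mul, abs_mul]
    calc _ ≤ (M * ptL ξ y) * (ptL ξ x * |(z 0 : ℝ)|) := by
          gcongr
          exact fz.trans (by gcongr)
      _ = _ := by ring
  rw [mul_sub, mul_sub, mul_sub]
  rw [abs_le] at *
  constructor <;> linarith

/-- The largest of the last two coordinates of `x × y`, in absolute value. -/
def crossSize (x y : Fin 3 → ℤ) : ℝ :=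
  max |(crossProduct x y 2 : ℝ)| |(crossProduct x y 1 : ℝ)|

theorem crossSize_le (ξ : ℝ) (x y : Fin 3 → ℤ) :
    crossSize x y ≤ |(y 0 : ℝ)| * ptL ξ x + |(x 0 : ℝ)| * ptL ξ y := by
  refine max_le ?_ ?_
  · have e : (crossProduct x y 2 : ℝ) = y 0 * (x 0 * ξ - x 1) - x 0 * (y 0 * ξ - y 1) := by
      simp [cross_apply]; ring
    rw [e]
    refine (abs_sub _ _).trans ?_
    rw [abs_mul, abs_mul]
    gcongr <;> exact le_max_left _ _
  · have e : (crossProduct x y 1 : ℝ) = x 0 * (y 0 * ξ ^ 2 - y 2) - y 0 * (x 0 * ξ ^ 2 - x 2) := by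
      simp [cross_apply]; ring
    rw [e, add_comm]
    refine (abs_sub _ _).trans ?_
    rw [abs_mul, abs_mul]
    gcongr <;> exact le_max_right _ _

theorem le_crossSize (ξ : ℝ) (x y : Fin 3 → ℤ) :
    |(y 0 : ℝ)| * ptL ξ x ≤ crossSize x y + |(x 0 : ℝ)| * ptL ξ y := by
  conv_lhs => rw [ptL, mul_max_of_nonneg _ _ (abs_nonneg _)]
  refine max_le ?_ ?_
  · have e : (y 0 : ℝ) * (x 0 * ξ - x 1) = crossProduct x y 2 + x 0 * (y 0 * ξ - y 1) := by
      simp [cross_apply]; ring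
    rw [← abs_mul, e]
    refine (abs_add_le _ _).trans ?_
    rw [abs_mul]
    gcongr <;> exact le_max_left _ _
  · have e : (y 0 : ℝ) * (x 0 * ξ ^ 2 - x 2) = -crossProduct x y 1 + x 0 * (y 0 * ξ ^ 2 - y 2) := by
      simp [cross_apply]; ring
    rw [← abs_mul, e]
    refine (abs_add_le _ _).trans ?_
    rw [abs_mul, abs_neg]
    gcongr <;> exact le_max_right _ _

theorem crossSize_eq_of_cross_eq {x y x' y' : Fin 3 → ℤ}
    (h : crossProduct x y = crossProduct x' y' ∨ crossProduct x y = -crossProduct x' y') :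
    crossSize x y = crossSize x' y' := by
  rcases h with h | h <;> simp [crossSize, h]

/-- Sequences whose logarithms differ by a bounded amount have the same order. -/
theorem sameOrder_of_abs_log_sub_le {A B : ℕ → ℝ} {κ : ℝ} (hA : ∀ k, 1 ≤ k → 0 < A k)
    (hB : ∀ k, 1 ≤ k → 0 < B k) (h : ∀ k, 1 ≤ k → |Real.log (A k) - Real.log (B k)| ≤ κ) :
    SameOrder A B := by
  have key : ∀ {a b : ℝ}, 0 < a → 0 < b → Real.log a ≤ κ + Real.log b → a ≤ Real.exp κ * b := by
    intro a b ha hb hab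
    rw [← Real.exp_log ha, ← Real.exp_log hb, ← Real.exp_add]
    exact Real.exp_le_exp.2 hab
  refine ⟨⟨Real.exp κ, Real.exp_pos _, fun k hk => key (hA k hk) (hB k hk) ?_⟩,
    ⟨Real.exp κ, Real.exp_pos _, fun k hk => key (hB k hk) (hA k hk) ?_⟩⟩
  · linarith [(abs_le.1 (h k hk)).2]
  · linarith [(abs_le.1 (h k hk)).1]

namespace IsMinimalSeq

variable {C : ℝ} {x : ℕ → Fin 3 → ℤ}

/-- The basic inequalities between the logarithms of `|x_{i,0}|` and `L(x_i)⁻¹`, coming from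
extremality, from `symDet x_i ≠ 0` and from the non-vanishing of a `3 × 3` determinant. -/
theorem exists_log_bounds (hirr : Irrational ξ) (hC : 0 < C) (h : IsMinimalSeq ξ C x) :
    ∃ κ : ℝ, 0 ≤ κ ∧
      (∀ i, (Real.goldenRatio - 1) * Real.log |(x (i + 1) 0 : ℝ)| - κ ≤ -Real.log (ptL ξ (x i))) ∧
      (∀ᶠ i in atTop, -Real.log (ptL ξ (x i)) ≤ Real.log |(x i 0 : ℝ)| + κ) ∧
      (∀ i, det3 (x i) (x (i + 1)) (x (i + 2)) ≠ 0 →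
        -Real.log (ptL ξ (x i)) + -Real.log (ptL ξ (x (i + 1))) - κ ≤
          Real.log |(x (i + 2) 0 : ℝ)|) := by
  have hN : ∀ i, 0 < |(x i 0 : ℝ)| := fun i => zero_lt_one.trans_le (h.one_le_abs i)
  have hL : ∀ i, 0 < ptL ξ (x i) := fun i => ptL_pos hirr (h.ne_zero i)
  have hM : 0 < 1 + 2 * |ξ| := by positivity
  have hM' : 0 < 1 + 2 * |ξ| + ptL ξ (x 0) := add_pos hM (hL 0)
  refine ⟨|Real.log C| + |Real.log (1 + 2 * |ξ| + ptL ξ (x 0))| + |Real.log (6 * (1 + 2 * |ξ|))|,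
    by positivity, fun i => ?_, ?_, fun i hi => ?_⟩
  · have h1 := Real.log_le_log (hL i) (h.ptL_le i)
    rw [Real.log_mul hC.ne' (Real.rpow_pos_of_pos (hN _) _).ne', Real.log_rpow (hN _)] at h1
    have h2 : -1 / Real.goldenRatio = -(Real.goldenRatio - 1) := by
      rw [div_eq_iff Real.goldenRatio_ne_zero]; linarith [Real.goldenRatio_sq]
    rw [h2] at h1
    linarith [le_abs_self (Real.log C), abs_nonneg (Real.log (1 + 2 * |ξ| + ptL ξ (x 0))),
      abs_nonneg (Real.log (6 * (1 + 2 * |ξ|)))]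
  · filter_upwards [h.eventually_symDet_ne_zero] with i hi
    have h1 : (1 : ℝ) ≤ |(symDet (x i) : ℝ)| := by exact_mod_cast Int.one_le_abs hi
    have h2 : ptL ξ (x i) ^ 2 ≤ |(x i 0 : ℝ)| * (ptL ξ (x 0) * ptL ξ (x i)) := by
      have h3 : ptL ξ (x i) ≤ ptL ξ (x 0) := h.strictAnti_ptL.antitone (Nat.zero_le i)
      calc ptL ξ (x i) ^ 2 = 1 * (ptL ξ (x i) * ptL ξ (x i)) := by ring
        _ ≤ _ := by
          exact mul_le_mul (h.one_le_abs i) (mul_le_mul_of_nonneg_right h3 (hL i).le)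
            (mul_pos (hL i) (hL i)).le (abs_nonneg _)
    have h3 : 1 ≤ (1 + 2 * |ξ| + ptL ξ (x 0)) * (|(x i 0 : ℝ)| * ptL ξ (x i)) := by
      linarith [h1.trans (abs_symDet_le ξ (x i))]
    have h4 := Real.log_le_log one_pos h3
    rw [Real.log_one, Real.log_mul hM'.ne' (mul_pos (hN i) (hL i)).ne',
      Real.log_mul (hN i).ne' (hL i).ne'] at h4
    linarith [abs_nonneg (Real.log C), le_abs_self (Real.log (1 + 2 * |ξ| + ptL ξ (x 0))),
      abs_nonneg (Real.log (6 * (1 + 2 * |ξ|)))]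
  · have h1 : (1 : ℝ) ≤ |(det3 (x i) (x (i + 1)) (x (i + 2)) : ℝ)| := by
      exact_mod_cast Int.one_le_abs hi
    have h2 := Real.log_le_log one_pos (h1.trans (abs_det3_le (h.abs_lt i).le (h.abs_lt (i + 1)).le
      (h.ptL_lt i).le (h.ptL_lt (i + 1)).le))
    rw [Real.log_one, Real.log_mul (by positivity)
      (mul_pos (mul_pos (hN _) (hL _)) (hL _)).ne', Real.log_mul (mul_pos (hN _) (hL _)).ne'
      (hL _).ne', Real.log_mul (hN _).ne' (hL _).ne'] at h2
    linarith [abs_nonneg (Real.log C), abs_nonneg (Real.log (1 + 2 * |ξ| + ptL ξ (x 0))),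
      le_abs_self (Real.log (6 * (1 + 2 * |ξ|)))]

/-- If `x_i × x_{i+1} = ± x_j × x_{j+1}`, then `|x_{i+1,0}| L(x_i)` and `|x_{j+1,0}| L(x_j)` have
the same order, provided that they dominate `|x_{i,0}| L(x_{i+1})` and `|x_{j,0}| L(x_{j+1})`. -/
theorem abs_log_sub_le_of_cross_eq (hirr : Irrational ξ) (h : IsMinimalSeq ξ C x) {i j : ℕ}
    (hij : crossProduct (x i) (x (i + 1)) = crossProduct (x j) (x (j + 1)) ∨
      crossProduct (x i) (x (i + 1)) = -crossProduct (x j) (x (j + 1)))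
    (hi : Real.log |(x i 0 : ℝ)| + Real.log (ptL ξ (x (i + 1))) + Real.log 2 ≤
      Real.log |(x (i + 1) 0 : ℝ)| + Real.log (ptL ξ (x i)))
    (hj : Real.log |(x j 0 : ℝ)| + Real.log (ptL ξ (x (j + 1))) + Real.log 2 ≤
      Real.log |(x (j + 1) 0 : ℝ)| + Real.log (ptL ξ (x j))) :
    |Real.log |(x (i + 1) 0 : ℝ)| + Real.log (ptL ξ (x i)) -
      (Real.log |(x (j + 1) 0 : ℝ)| + Real.log (ptL ξ (x j)))| ≤ Real.log 3 := by
  have hN : ∀ i, 0 < |(x i 0 : ℝ)| := fun i => zero_lt_one.trans_le (h.one_le_abs i)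
  have hL : ∀ i, 0 < ptL ξ (x i) := fun i => ptL_pos hirr (h.ne_zero i)
  have hdom : ∀ {i}, Real.log |(x i 0 : ℝ)| + Real.log (ptL ξ (x (i + 1))) + Real.log 2 ≤
      Real.log |(x (i + 1) 0 : ℝ)| + Real.log (ptL ξ (x i)) →
      |(x i 0 : ℝ)| * ptL ξ (x (i + 1)) * 2 ≤ |(x (i + 1) 0 : ℝ)| * ptL ξ (x i) := by
    intro i hi
    rw [← Real.log_mul (hN _).ne' (hL _).ne', ← Real.log_mul (hN _).ne' (hL _).ne',
      ← Real.log_mul (mul_pos (hN _) (hL _)).ne' two_ne_zero] at hi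
    exact (Real.log_le_log_iff (mul_pos (mul_pos (hN _) (hL _)) two_pos)
      (mul_pos (hN _) (hL _))).1 hi
  have hi' := hdom hi
  have hj' := hdom hj
  have hW := crossSize_eq_of_cross_eq hij
  have a1 := crossSize_le ξ (x i) (x (i + 1))
  have a2 := le_crossSize ξ (x i) (x (i + 1))
  have b1 := crossSize_le ξ (x j) (x (j + 1))
  have b2 := le_crossSize ξ (x j) (x (j + 1))
  rw [← Real.log_mul (hN _).ne' (hL _).ne', ← Real.log_mul (hN _).ne' (hL _).ne']
  have pi := mul_pos (hN (i + 1)) (hL i)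
  have pj := mul_pos (hN (j + 1)) (hL j)
  have l1 := Real.log_le_log pi (show _ ≤ 3 * (|(x (j + 1) 0 : ℝ)| * ptL ξ (x j)) by linarith)
  have l2 := Real.log_le_log pj (show _ ≤ 3 * (|(x (i + 1) 0 : ℝ)| * ptL ξ (x i)) by linarith)
  rw [Real.log_mul three_ne_zero pj.ne'] at l1
  rw [Real.log_mul three_ne_zero pi.ne'] at l2
  rw [abs_le]
  constructor <;> linarith

end IsMinimalSeq

/-- The linear system behind the estimates for three consecutive minimal points that are linearly
independent: `n₁, n₂` are the logarithms of the first coordinates of the last two points, and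
`l₀, l₁` those of `L⁻¹` at the first two. -/
theorem log_estimates_of_independent {g κ n₁ n₂ l₀ l₁ : ℝ} (hg : g ^ 2 = g + 1) (hg1 : 1 < g)
    (hg2 : g < 2) (hκ : 0 ≤ κ) (h₀ : (g - 1) * n₁ - κ ≤ l₀) (h₁ : (g - 1) * n₂ - κ ≤ l₁)
    (h₂ : l₁ ≤ n₁ + κ) (h₃ : l₀ + l₁ - κ ≤ n₂) :
    |n₂ - g * n₁| ≤ 15 * κ ∧ |l₁ - n₁| ≤ 15 * κ ∧ |l₀ - (g - 1) * n₁| ≤ 15 * κ := by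
  have hgκ : g * κ ≤ 2 * κ := by nlinarith
  have hgκ' : κ ≤ g * κ := by nlinarith
  have a1 : g * n₁ - 9 * κ ≤ n₂ := by
    have b1 : 0 ≤ (1 + g) * ((2 - g) * n₂ - (g - 1) * n₁ + 3 * κ) :=
      mul_nonneg (by linarith) (by linarith)
    have b2 : (1 + g) * ((2 - g) * n₂ - (g - 1) * n₁ + 3 * κ) =
        n₂ - g * n₁ + 3 * κ + 3 * (g * κ) := by linear_combination (-n₂ - n₁) * hg
    linarith
  have a2 : n₂ ≤ g * n₁ + 4 * κ := by
    have b1 : 0 ≤ g * (n₁ + 2 * κ - (g - 1) * n₂) := mul_nonneg (by linarith) (by linarith)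
    have b2 : g * (n₁ + 2 * κ - (g - 1) * n₂) = g * n₁ + 2 * (g * κ) - n₂ := by
      linear_combination (-n₂) * hg
    linarith
  have a3 : n₁ - 10 * κ ≤ l₁ := by
    have b1 : 0 ≤ (g - 1) * (n₂ - (g * n₁ - 9 * κ)) := mul_nonneg (by linarith) (by linarith)
    have b2 : (g - 1) * (n₂ - (g * n₁ - 9 * κ)) = (g - 1) * n₂ - n₁ + 9 * (g * κ) - 9 * κ := by
      linear_combination (-n₁) * hg
    linarith
  refine ⟨abs_le.2 ⟨by linarith, by linarith⟩, abs_le.2 ⟨by linarith, by linarith⟩,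
    abs_le.2 ⟨by linarith, by linarith⟩⟩

/-- The sequence of points `y_k` attached to an extremal number is formed by the minimal points
`x_i` for which `x_{i-1}, x_i, x_{i+1}` are linearly independent. -/
theorem IsExtremal.exists_isApproxSeq (hξ : IsExtremal ξ) :
    ∃ (Y : ℕ → ℕ) (y : ℕ → Fin 3 → ℤ), IsApproxSeq ξ Y y := by
  obtain ⟨C, hC, x, h⟩ := hξ.exists_isMinimalSeq
  have hirr := hξ.1
  obtain ⟨κ, hκ, F1, F2, F3⟩ := h.exists_log_bounds hirr hC
  have hN : ∀ i, 0 < |(x i 0 : ℝ)| := fun i => zero_lt_one.trans_le (h.one_le_abs i)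
  have hL : ∀ i, 0 < ptL ξ (x i) := fun i => ptL_pos hirr (h.ne_zero i)
  have hg := Real.goldenRatio_sq
  have hg1 := Real.one_lt_goldenRatio
  have hg2 := Real.goldenRatio_lt_two
  obtain ⟨n, hn⟩ : ∃ n : ℕ → ℝ, ∀ i, n i = Real.log |(x i 0 : ℝ)| := ⟨_, fun _ => rfl⟩
  obtain ⟨l, hl⟩ : ∃ l : ℕ → ℝ, ∀ i, l i = -Real.log (ptL ξ (x i)) := ⟨_, fun _ => rfl⟩
  have hlog : ∀ i, Real.log (ptL ξ (x i)) = -l i := fun i => by rw [hl, neg_neg]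
  simp only [← hn, ← hl] at F1 F2 F3
  have hntop : Tendsto n atTop atTop := by
    simp only [funext hn]
    exact Real.tendsto_log_atTop.comp h.tendsto_abs
  have hnmono : Monotone n := fun i j hij => by
    rw [hn, hn]
    exact Real.log_le_log (hN i) (by exact_mod_cast h.strictMono_abs.monotone hij)
  have hlmono : Monotone l := fun i j hij => by
    rw [hl, hl]
    exact neg_le_neg (Real.log_le_log (hL j) (h.strictAnti_ptL.antitone hij))
  -- beyond the index `J` all estimates hold
  obtain ⟨J, hJ⟩ := eventually_atTop.1 (F2.and (h.eventually_symDet_ne_zero.and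
    (hntop.eventually_ge_atTop ((Real.log 2 + 30 * κ) / (2 - Real.goldenRatio)))))
  have hind : ∀ i, J ≤ i → det3 (x i) (x (i + 1)) (x (i + 2)) ≠ 0 →
      |n (i + 2) - Real.goldenRatio * n (i + 1)| ≤ 15 * κ ∧ |l (i + 1) - n (i + 1)| ≤ 15 * κ ∧
      |l i - (Real.goldenRatio - 1) * n (i + 1)| ≤ 15 * κ := fun i hi hdet =>
    log_estimates_of_independent hg hg1 hg2 hκ (F1 i) (F1 (i + 1)) (hJ (i + 1) (by omega)).1
      (F3 i hdet)
  have hlarge : ∀ i, J ≤ i → Real.log 2 + 30 * κ ≤ (2 - Real.goldenRatio) * n (i + 1) := by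
    intro i hi
    have := (hJ (i + 1) (by omega)).2.2
    rw [div_le_iff₀ (by linarith)] at this
    linarith
  set P : ℕ → Prop := fun i => J ≤ i ∧ det3 (x i) (x (i + 1)) (x (i + 2)) ≠ 0 with hP
  have hinf : (Set.ofPred P).Infinite := by
    refine Nat.frequently_atTop_iff_infinite.1 ?_
    exact ((h.frequently_det3_ne_zero hξ).and_eventually (eventually_ge_atTop J)).mono
      fun i hi => ⟨hi.2, hi.1⟩
  obtain ⟨m, hm⟩ : ∃ m, m = Nat.nth P := ⟨_, rfl⟩
  have hmP : ∀ k, J ≤ m k ∧ det3 (x (m k)) (x (m k + 1)) (x (m k + 2)) ≠ 0 := fun k => by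
    rw [hm]; exact Nat.nth_mem_of_infinite hinf k
  have hmlt : ∀ k, m k < m (k + 1) := fun k => by
    rw [hm]; exact Nat.nth_strictMono hinf (Nat.lt_succ_self k)
  -- between two consecutive indices the minimal points stay in a plane
  have hchain : ∀ k, crossProduct (x (m k + 1)) (x (m k + 2)) =
      crossProduct (x (m (k + 1))) (x (m (k + 1) + 1)) ∨
      crossProduct (x (m k + 1)) (x (m k + 2)) =
        -crossProduct (x (m (k + 1))) (x (m (k + 1) + 1)) := by
    intro k
    have key : ∀ i, m k + 1 ≤ i → i ≤ m (k + 1) →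
        crossProduct (x (m k + 1)) (x (m k + 2)) = crossProduct (x i) (x (i + 1)) ∨
        crossProduct (x (m k + 1)) (x (m k + 2)) = -crossProduct (x i) (x (i + 1)) := by
      intro i hi
      induction i, hi using Nat.le_induction with
      | base => exact fun _ => Or.inl rfl
      | succ i hi ih =>
        intro hi'
        have h0 : det3 (x i) (x (i + 1)) (x (i + 2)) = 0 := by
          by_contra hne
          have hPi : P i := ⟨by have := (hmP k).1; omega, hne⟩
          have := Nat.le_nth_of_lt_nth_succ (p := P) (k := k) (a := i)
            (by rw [← hm]; omega) hPi
          rw [← hm] at this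
          omega
        rcases h.cross_succ_eq h0 with h1 | h1 <;> rcases ih (by omega) with h2 | h2 <;>
          rw [h2, h1]
        · exact Or.inl rfl
        · exact Or.inr rfl
        · exact Or.inr (neg_neg _).symm
        · exact Or.inl rfl
    exact key _ (hmlt k) le_rfl
  have hlog3 : 0 ≤ Real.log 3 := Real.log_nonneg (by norm_num)
  have hgrow : ∀ k, |n (m (k + 1) + 1) - Real.goldenRatio * n (m k + 1)| ≤
      3 * (Real.log 3 + 45 * κ) := by
    intro k
    obtain ⟨a1, a2, a3⟩ := hind _ (hmP k).1 (hmP k).2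
    obtain ⟨b1, b2, b3⟩ := hind _ (hmP (k + 1)).1 (hmP (k + 1)).2
    have la := hlarge _ (hmP k).1
    have lb := hlarge _ (hmP (k + 1)).1
    have ha := hnmono (Nat.le_succ (m (k + 1)))
    have hb := hlmono (Nat.le_succ (m k + 1))
    rw [abs_le] at a1 a2 a3 b1 b2 b3
    have hc := h.abs_log_sub_le_of_cross_eq hirr (hchain k)
      (by
        simp only [hlog, ← hn]
        have hn0 : 0 ≤ n (m k + 1) := by rw [hn]; exact Real.log_nonneg (h.one_le_abs _)
        have hg3 : 2 - Real.goldenRatio ≤ Real.goldenRatio - 1 := by nlinarith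
        have := mul_le_mul_of_nonneg_right hg3 hn0
        simp only [Nat.succ_eq_add_one] at hb
        linarith [a1.1])
      (by
        simp only [hlog, ← hn]
        simp only [Nat.succ_eq_add_one] at ha
        linarith [b2.1, b3.2])
    simp only [hlog, ← hn] at hc
    rw [abs_le] at hc
    generalize n (m (k + 1) + 1) = n' at *
    generalize n (m k + 1) = n₀ at *
    have e1 : (1 + Real.goldenRatio) *
        ((Real.goldenRatio - 1) * n₀ - (2 - Real.goldenRatio) * n') =
        Real.goldenRatio * n₀ - n' := by linear_combination (n₀ + n') * hg
    have c1 : |(Real.goldenRatio - 1) * n₀ - (2 - Real.goldenRatio) * n'| ≤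
        Real.log 3 + 45 * κ := by
      simp only [add_assoc, Nat.reduceAdd] at hc
      exact abs_le.2 ⟨by linarith [hc.1, hc.2], by linarith [hc.1, hc.2]⟩
    rw [abs_sub_comm, ← e1, abs_mul, abs_of_pos (by linarith)]
    gcongr
    linarith
  refine ⟨fun k => (x (m k + 1) 0).natAbs, fun k => x (m k + 1), ?_⟩
  have hY : ∀ k, (((x (m k + 1) 0).natAbs : ℕ) : ℝ) = |(x (m k + 1) 0 : ℝ)| := fun k => by
    rw [Nat.cast_natAbs, Int.cast_abs]
  have hdet : ∀ k, n (m (k + 2) + 1) - l (m k + 1) - l (m (k + 1) + 1) ≤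
      6 * (Real.log 3 + 45 * κ) + 30 * κ := by
    intro k
    have g1 := (abs_le.1 (hgrow k)).2
    have g2 := (abs_le.1 (hgrow (k + 1))).2
    have a2 := (abs_le.1 (hind _ (hmP k).1 (hmP k).2).2.1).1
    have b2 := (abs_le.1 (hind _ (hmP (k + 1)).1 (hmP (k + 1)).2).2.1).1
    have e1 := mul_le_mul_of_nonneg_left g1 (show 0 ≤ Real.goldenRatio - 1 by linarith)
    have e2 : (Real.goldenRatio - 1) * (n (m (k + 1) + 1) - Real.goldenRatio * n (m k + 1)) =
        (Real.goldenRatio - 1) * n (m (k + 1) + 1) - n (m k + 1) := by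
      linear_combination (-n (m k + 1)) * hg
    have e3 : (Real.goldenRatio - 1) * (3 * (Real.log 3 + 45 * κ)) ≤
        1 * (3 * (Real.log 3 + 45 * κ)) := by gcongr; linarith
    rw [e2] at e1
    have e4 : m (k + 1 + 1) = m (k + 2) := rfl
    rw [e4] at g2
    linarith
  constructor
  · intro k _
    rw [Int.natAbs_pos]
    intro h0
    have := hN (m k + 1)
    rw [h0] at this; simp at this
  · intro k _
    have := h.strictMono_abs (show m k + 1 < m (k + 1) + 1 by have := hmlt k; omega)
    simp only [Int.abs_eq_natAbs] at this
    exact_mod_cast this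
  · refine sameOrder_of_abs_log_sub_le (κ := 3 * (Real.log 3 + 45 * κ)) (fun k _ => ?_)
      (fun k _ => ?_) fun k _ => ?_
    · rw [hY]; exact hN _
    · rw [hY]; exact Real.rpow_pos_of_pos (hN _) _
    · rw [hY, hY, Real.log_rpow (hN _), ← hn, ← hn]; exact hgrow k
  · have hle : ∀ i, ptNorm (x i) ≤ (1 + |ξ| + ξ ^ 2 + ptL ξ (x 0)) * |(x i 0 : ℝ)| := by
      intro i
      have h1 : ptL ξ (x i) ≤ ptL ξ (x 0) * |(x i 0 : ℝ)| :=
        (h.strictAnti_ptL.antitone (Nat.zero_le i)).trans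
          (le_mul_of_one_le_right (hL 0).le (h.one_le_abs i))
      have p1 : 0 ≤ |ξ| * |(x i 0 : ℝ)| := by positivity
      have p2 : 0 ≤ ξ ^ 2 * |(x i 0 : ℝ)| := by positivity
      have p3 : 0 ≤ ptL ξ (x 0) * |(x i 0 : ℝ)| := mul_nonneg (hL 0).le (abs_nonneg _)
      refine max_le (by linarith) (max_le ?_ ?_)
      · have e : (x i 1 : ℝ) = x i 0 * ξ - (x i 0 * ξ - x i 1) := by ring
        have h2 : |(x i 0 : ℝ) * ξ - x i 1| ≤ ptL ξ (x i) := le_max_left _ _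
        have h3 : |(x i 1 : ℝ)| ≤ |(x i 0 : ℝ) * ξ| + |(x i 0 : ℝ) * ξ - x i 1| := by
          conv_lhs => rw [e]
          exact abs_sub _ _
        rw [abs_mul] at h3
        linarith [hN i]
      · have e : (x i 2 : ℝ) = x i 0 * ξ ^ 2 - (x i 0 * ξ ^ 2 - x i 2) := by ring
        have h2 : |(x i 0 : ℝ) * ξ ^ 2 - x i 2| ≤ ptL ξ (x i) := le_max_right _ _
        have h3 : |(x i 2 : ℝ)| ≤ |(x i 0 : ℝ) * ξ ^ 2| + |(x i 0 : ℝ) * ξ ^ 2 - x i 2| := by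
          conv_lhs => rw [e]
          exact abs_sub _ _
        rw [abs_mul, abs_of_nonneg (sq_nonneg ξ)] at h3
        linarith [hN i]
    refine ⟨⟨1 + |ξ| + ξ ^ 2 + ptL ξ (x 0), ?_, fun k _ => ?_⟩, ⟨1, one_pos, fun k _ => ?_⟩⟩
    · have := hL 0
      positivity
    · simp only [hY]; exact hle _
    · simp only [hY, one_mul]; exact abs_coord_zero_le _
  · refine sameOrder_of_abs_log_sub_le (κ := 15 * κ) (fun k _ => hL _) (fun k _ => ?_)
      fun k _ => ?_
    · rw [hY]; exact inv_pos.2 (hN _)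
    · rw [hY, Real.log_inv, hlog, ← hn, ← abs_neg]
      refine le_trans (le_of_eq ?_) (hind _ (hmP k).1 (hmP k).2).2.1
      congr 1; ring
  · intro k _
    exact Int.one_le_abs (hJ _ (by have := (hmP k).1; omega)).2.1
  · refine ⟨(1 + 2 * |ξ| + ptL ξ (x 0)) * Real.exp (15 * κ),
      mul_pos (add_pos (by positivity) (hL 0)) (Real.exp_pos _), fun k _ => ?_⟩
    have h1 : |(x (m k + 1) 0 : ℝ)| * ptL ξ (x (m k + 1)) ≤ Real.exp (15 * κ) := by
      rw [← Real.log_le_iff_le_exp (mul_pos (hN _) (hL _)), Real.log_mul (hN _).ne' (hL _).ne',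
        hlog, ← hn]
      linarith [(abs_le.1 (hind _ (hmP k).1 (hmP k).2).2.1).1]
    have h2 : ptL ξ (x (m k + 1)) ^ 2 ≤
        ptL ξ (x 0) * (|(x (m k + 1) 0 : ℝ)| * ptL ξ (x (m k + 1))) := by
      have h3 : ptL ξ (x (m k + 1)) ≤ ptL ξ (x 0) := h.strictAnti_ptL.antitone (Nat.zero_le _)
      rw [sq]
      exact mul_le_mul h3 (le_mul_of_one_le_left (hL _).le (h.one_le_abs _)) (hL _).le (hL 0).le
    have h3 := abs_symDet_le ξ (x (m k + 1))
    have h4 : 0 < 1 + 2 * |ξ| + ptL ξ (x 0) := add_pos (by positivity) (hL 0)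
    have h5 := mul_le_mul_of_nonneg_left h1 h4.le
    rw [mul_one]
    linarith
  · intro k _
    refine Int.one_le_abs ?_
    rw [det3_eq_dot_cross]
    have c0 := hchain k
    have c1 := hchain (k + 1)
    have d1 := (hmP (k + 1)).2
    rw [det3_eq_dot_cross, triple_product_permutation, triple_product_permutation] at d1
    have hsucc : ∀ j, m j + 1 < m (j + 1) + 1 := fun j => by have := hmlt j; omega
    refine dot_cross_ne_zero (u := crossProduct (x (m (k + 1))) (x (m (k + 1) + 1)))
      (w := crossProduct (x (m (k + 1) + 1)) (x (m (k + 1) + 2))) (t := x (m (k + 1) + 2))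
      ?_ ?_ ?_ ?_ (h.cross_ne_zero (hsucc k)) (h.cross_ne_zero (hsucc (k + 1)))
      (h.cross_ne_zero (Nat.lt_succ_self _)) (dot_cross_self _ _) d1
    · rw [dotProduct_comm]
      have := dot_self_cross (x (m k + 1)) (x (m k + 2))
      rcases c0 with c0 | c0 <;> rw [c0] at this
      · exact this
      · rwa [dotProduct_neg, neg_eq_zero] at this
    · rw [dotProduct_comm]; exact dot_cross_self _ _
    · rw [dotProduct_comm]; exact dot_self_cross _ _
    · rw [dotProduct_comm]
      have := dot_cross_self (x (m (k + 1 + 1))) (x (m (k + 1 + 1) + 1))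
      rcases c1 with c1 | c1 <;> rw [c1]
      · exact this
      · rw [dotProduct_neg, neg_eq_zero]; exact this
  · refine ⟨6 * (1 + 2 * |ξ|) * Real.exp (6 * (Real.log 3 + 45 * κ) + 30 * κ), by positivity,
      fun k _ => ?_⟩
    have hlt : ∀ j, m j + 1 ≤ m (j + 1) + 1 := fun j => by have := hmlt j; omega
    have h1 := abs_det3_le (h.strictMono_abs.monotone (hlt k))
      (h.strictMono_abs.monotone (hlt (k + 1))) (h.strictAnti_ptL.antitone (hlt k))
      (h.strictAnti_ptL.antitone (hlt (k + 1)))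
    rw [mul_one]
    refine h1.trans ?_
    gcongr
    rw [← Real.log_le_iff_le_exp (mul_pos (mul_pos (hN _) (hL _)) (hL _)),
      Real.log_mul (mul_pos (hN _) (hL _)).ne' (hL _).ne', Real.log_mul (hN _).ne' (hL _).ne',
      hlog, hlog, ← hn]
    linarith [hdet k]

end Existence

end

theorem theorem8p2 (ξ : ℝ) (hξ : IsExtremal ξ) :
    -- the sequences from which the polynomials `Q_k` are built exist
    (∃ (Y : ℕ → ℕ) (y : ℕ → Fin 3 → ℤ), IsApproxSeq ξ Y y) ∧
    -- the main result, for every choice of such sequences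
    (∀ (Y : ℕ → ℕ) (y : ℕ → Fin 3 → ℤ), IsApproxSeq ξ Y y →
      ∃ (k₀ : ℕ) (c₁ c₂ : ℝ) (α : ℕ → ℂ), 1 ≤ k₀ ∧ 0 < c₁ ∧ 0 < c₂ ∧
        (∀ k, k₀ ≤ k →
          Irreducible ((Qpoly y k).map (Int.castRingHom ℚ)) ∧
          (Qpoly y k).natDegree = 2 ∧
          (Polynomial.aeval (α k) (Qpoly y k) = 0 ∧
            c₁ * algHeight (α k) ^ (-2 * Real.goldenRatio ^ 2) ≤ ‖(ξ : ℂ) - α k‖ ∧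
            ‖(ξ : ℂ) - α k‖ ≤ c₂ * algHeight (α k) ^ (-2 * Real.goldenRatio ^ 2)) ∧
          (∀ β : ℂ, Polynomial.aeval β (Qpoly y k) = 0 →
            c₁ * algHeight β ^ (-2 * Real.goldenRatio ^ 2) ≤ ‖(ξ : ℂ) - β‖ →
            ‖(ξ : ℂ) - β‖ ≤ c₂ * algHeight β ^ (-2 * Real.goldenRatio ^ 2) →
            β = α k)) ∧
        ∃ c₃ : ℝ, 0 < c₃ ∧ ∀ β : ℂ, IsAlgebraic ℚ β → (minpoly ℚ β).natDegree ≤ 2 →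
          (∀ k, k₀ ≤ k → β ≠ α k) →
          c₃ * algHeight β ^ (-4 : ℤ) ≤ ‖(ξ : ℂ) - β‖) ∧
    -- the exponent `2γ²` is optimal for approximation by quadratic numbers
    (∃ c : ℝ, 0 < c ∧
      {β : ℂ | IsAlgebraic ℚ β ∧ (minpoly ℚ β).natDegree = 2 ∧
        ‖(ξ : ℂ) - β‖ ≤ c * algHeight β ^ (-2 * Real.goldenRatio ^ 2)}.Infinite) ∧
    (∃ c : ℝ, 0 < c ∧
      ∀ β : ℂ, IsAlgebraic ℚ β → (minpoly ℚ β).natDegree ≤ 2 →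
        ¬ ‖(ξ : ℂ) - β‖ ≤ c * algHeight β ^ (-2 * Real.goldenRatio ^ 2)) := by
  obtain ⟨Y, y, h⟩ := hξ.exists_isApproxSeq
  exact ⟨⟨Y, y, h⟩, fun Y y h => h.quadratic_approximation, h.optimal_exponent⟩
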